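/- **Setting.** Let $n\ge 1$, $d=2n$, $M\ge 0$, and let $H$ be a tight-binding Hamiltonian on $\ell^2(\mathbb Z^{d},\mathbb C^M)$, $(H\varphi)_\alpha(x)=\sum_{y}\sum_\beta t_{x,y}^{\alpha,\beta}\varphi_\beta(y)$, whose hopping amplitudes are Hermitian ($t_{y,x}^{\beta,\alpha}=\overline{t_{x,y}^{\alpha,\beta}}$), uniformly bounded and of finite range. The standing assumption on the Fermi level $E_{\rm F}\in\mathbb R$ is that there are constants $C_0,\xi_0>0$ with $$\sup_{\varepsilon>0}\bigl\|\chi_{\{x\}}(E_{\rm F}+i\varepsilon-H)^{-1}\chi_{\{y\}}\bigr\|\le C_0e^{-|x-y|/\xi_0}\qquad(x,y\in\mathbb Z^d),$$ where $\chi_{\{x\}}$ is multiplication by the characteristic function of the site $x$. Let $P_{\rm F}$ be the spectral projection of $H$ onto energies below $E_{\rm F}$. Let $\sigma_0=1,\sigma_1,\sigma_2,\sigma_3$ be the identity and the Pauli matrices and, on $\mathbb C^{2^n}=(\mathbb C^2)^{\otimes n}$, put $\gamma^{(2m-1)}=\sigma_0^{\otimes(m-1)}\otimes\sigma_1\otimes\sigma_3^{\otimes(n-m)}$,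 $\gamma^{(2m)}=\sigma_0^{\otimes(m-1)}\otimes\sigma_2\otimes\sigma_3^{\otimes(n-m)}$ for $1\le m\le n$, and $\gamma^{(2n+1)}=\sigma_3^{\otimes n}$. For $a\in\mathbb R^{d}\setminus\mathbb Z^{d}$ let $D_a=\sum_{j=1}^{2n}\frac{x^{(j)}-a^{(j)}}{|x-a|}\,\gamma^{(j)}$ on $\ell^2(\mathbb Z^{d},\mathbb C^M)\otimes\mathbb C^{2^n}$, and set $A=\gamma^{(2n+1)}(P_{\rm F}-D_aP_{\rm F}D_a)$, where $P_{\rm F}$ stands for $P_{\rm F}\otimes1$. The integer-valued index is $\frac12\{\dim\ker(A-1)-\dim\ker(A+1)\}$. **Symmetries.** A time-reversal symmetry is a transformation $\Theta\varphi=U^\Theta\overline\varphi$ with $\Theta H=H\Theta$, and a particle-hole symmetry is a transformation $\Xi\varphi=U^\Xi\overline\varphi$ with $\Xi H=-H\Xi$; here $U^\Theta,U^\Xi$ are unitary matrices acting on the internal space $\mathbb C^M$, independently of the site. Such a symmetry is called even ($+1$) or odd ($-1$) if its square is $1$ or $-1$. A chiral symmetry is an operator $S=S^*$ with $S^2=1$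 and $SHS=-H$. With $(\mathrm{TRS},\mathrm{PHS},\mathrm{CHS})$ indicating which symmetries are required ($0$: not required; $\mathrm{CHS}=1$: chiral symmetry required), the $\mathbb Z_2$ entries of the periodic table in even dimensions, where the table has period $8$ in $d$, are: $d\equiv2\pmod 8$: AII $(-1,0,0)$ and DIII $(-1,+1,1)$; $d\equiv4$: C $(0,-1,0)$ and CII $(-1,-1,1)$; $d\equiv6$: AI $(+1,0,0)$ and CI $(+1,-1,1)$; $d\equiv0$: D $(0,+1,0)$ and BDI $(+1,+1,1)$. For classes with particle-hole or chiral symmetry $E_{\rm F}=0$. **Theorem 2.** Let $(\text{class},d=2n)$ be a $\mathbb Z_2$ entry of the table, fix symmetry operators as prescribed by the class, and let $H$ satisfy the standing assumption and have these symmetries. Then: 1. $\ker(A-1)$ and $\ker(A+1)$ are finite dimensional, and the integer-valued index vanishes. 2. $\dim\ker(A-1)$ is even, with $\frac12\dim\ker(A-1)=\dim\bigl(\ker(A-1)\cap\ker(\gamma^{(2n+1)}-1)\bigr)$, so that the $\mathbb Z_2$ index $$\mathrm{Ind}_2^{(2n)}(D_a,P_{\rm F}):=\tfrac12\dim\ker\bigl[\gamma^{(2n+1)}(P_{\rm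 F}-D_aP_{\rm F}D_a)-1\bigr]\ \text{ modulo } 2$$ is defined. For every real $\lambda$ with $0<|\lambda|<1$, $\ker(A-\lambda)$ is finite dimensional, and $\frac12\dim\ker(A-\lambda)=\dim\bigl(\ker(A-\lambda)\cap\ker(\gamma^{(2n+1)}-1)\bigr)$ is an even integer. 3. The $\mathbb Z_2$ index is continuous in the norm of symmetry-preserving perturbations: there is $\delta>0$ such that every tight-binding Hamiltonian $H'$ which has the same symmetries (with respect to the same operators) and satisfies $\|H'-H\|<\delta$ has finite-dimensional $\ker(A'-1)$ and the same $\mathbb Z_2$ index as $H$, where $A'$ is formed from $H'$ as $A$ is from $H$. 4. Consequently, the $\mathbb Z_2$ index is constant along every norm-continuous path $g\mapsto H_g$, $g\in[0,1]$, of tight-binding Hamiltonians with these symmetries all of which satisfy the standing assumption at $E_{\rm F}$. -/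

import Mathlib

open scoped ENNReal

noncomputable section

namespace TopIns

/-! ## Wavefunctions on the lattice -/

/-- The sites of the hypercubic lattice `ℤ^d`. -/
abbrev Site (d : ℕ) : Type := Fin d → ℤ

/-- A lattice site as a point of the Euclidean space `ℝ^d`. -/
def Site.toEuclid {d : ℕ} (x : Site d) : EuclideanSpace ℝ (Fin d) :=
  WithLp.toLp 2 (fun i => (x i : ℝ))

/-- The single-particle Hilbert space `ℓ²(ℤ^d, ℂ^M)`. -/
abbrev WaveFn (d M : ℕ) : Type :=
  lp (fun _ : Site d => EuclideanSpace ℂ (Fin M)) 2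

/-- A sitewise map that does not increase norms by more than a constant factor preserves `ℓ²`. -/
theorem memWave_of_le {d M : ℕ} (φ : WaveFn d M) (ψ : Site d → EuclideanSpace ℂ (Fin M)) (C : ℝ)
    (h : ∀ x, ‖ψ x‖ ≤ C * ‖φ x‖) : Memℓp ψ 2 := by
  have h2 : (0 : ℝ) < (2 : ℝ≥0∞).toReal := by norm_num
  apply memℓp_gen
  have hs := ((lp.memℓp φ).summable h2).mul_left (C ^ 2)
  refine Summable.of_nonneg_of_le (fun x => by positivity) (fun x => ?_) hs
  have h3 := pow_le_pow_left₀ (norm_nonneg _) (h x) 2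
  simpa [mul_pow] using h3

/-- The bounded operator on `ℓ²(ℤ^d, ℂ^M)` acting at each site `x` by the operator `T x` on the
internal space `ℂ^M`, for a uniformly bounded family `T`. -/
def fiberOp {d M : ℕ}
    (T : Site d → (EuclideanSpace ℂ (Fin M) →L[ℂ] EuclideanSpace ℂ (Fin M)))
    (C : ℝ) (hC : ∀ x, ‖T x‖ ≤ C) : WaveFn d M →L[ℂ] WaveFn d M :=
  LinearMap.mkContinuous
    { toFun := fun φ => ⟨fun x => T x (φ x),
        memWave_of_le φ _ C (fun x => (T x).le_of_opNorm_le (hC x) (φ x))⟩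
      map_add' := fun φ ψ => by
        ext x i
        simp
        rfl
      map_smul' := fun c φ => by
        ext x i
        simp }
    C
    (fun φ => by
      have hC0 : 0 ≤ C := (norm_nonneg _).trans (hC 0)
      have h2 : (0 : ℝ) < (2 : ℝ≥0∞).toReal := by norm_num
      refine lp.norm_le_of_forall_sum_le h2 (by positivity) (fun s => ?_)
      have h1 : ∀ x, ‖T x (φ x)‖ ^ (2 : ℝ≥0∞).toReal ≤ C ^ 2 * ‖φ x‖ ^ (2 : ℝ≥0∞).toReal := by
        intro x
        have h3 := pow_le_pow_left₀ (norm_nonneg _) ((T x).le_of_opNorm_le (hC x) (φ x)) 2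
        simpa [mul_pow] using h3
      refine (Finset.sum_le_sum (fun x _ => h1 x)).trans ?_
      rw [← Finset.mul_sum]
      have h4 := lp.sum_rpow_le_norm_rpow h2 φ s
      calc C ^ 2 * ∑ x ∈ s, ‖φ x‖ ^ (2 : ℝ≥0∞).toReal
          ≤ C ^ 2 * ‖φ‖ ^ (2 : ℝ≥0∞).toReal := by gcongr
        _ = (C * ‖φ‖) ^ (2 : ℝ≥0∞).toReal := by simp [mul_pow])

/-- Complex conjugation of wavefunctions, `(conj φ)_α(x) = conj (φ_α(x))`. -/
def conj {d M : ℕ} (φ : WaveFn d M) : WaveFn d M :=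
  ⟨fun x => WithLp.toLp 2 (fun α => starRingEnd ℂ (φ x α)),
    memWave_of_le φ _ 1 (fun x => by simp [EuclideanSpace.norm_eq])⟩

/-- The site-independent operator on `ℓ²(ℤ^d, ℂ^M)` given by a matrix on the internal space. -/
def onsite (d : ℕ) {M : ℕ} (u : Matrix (Fin M) (Fin M) ℂ) : WaveFn d M →L[ℂ] WaveFn d M :=
  fiberOp (fun _ => Matrix.toEuclideanCLM (𝕜 := ℂ) u) ‖Matrix.toEuclideanCLM (𝕜 := ℂ) u‖
    (fun _ => le_rfl)

/-- The antilinear transformation `φ ↦ U (conj φ)` with a site-independent matrix `U = u`. -/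
def antiOp {d M : ℕ} (u : Matrix (Fin M) (Fin M) ℂ) (φ : WaveFn d M) : WaveFn d M :=
  onsite d u (conj φ)

/-- Multiplication by the characteristic function of the single site `x`. -/
def siteProj {d : ℕ} (M : ℕ) (x : Site d) : WaveFn d M →L[ℂ] WaveFn d M :=
  fiberOp (fun y => if y = x then ContinuousLinearMap.id ℂ _ else 0) 1 (fun y => by
    split_ifs
    · exact ContinuousLinearMap.norm_id_le
    · simp)

/-- Multiplication by the function `x ↦ (x^{(j)} - a^{(j)}) / |x - a|`. -/
def unitPosition {d : ℕ} (M : ℕ) (a : EuclideanSpace ℝ (Fin d)) (j : Fin d) :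
    WaveFn d M →L[ℂ] WaveFn d M :=
  fiberOp (fun x => (((x.toEuclid j - a j) / ‖x.toEuclid - a‖ : ℝ) : ℂ) •
      ContinuousLinearMap.id ℂ _) 1 (fun x => by
    rw [norm_smul]
    refine mul_le_one₀ ?_ (norm_nonneg _) ContinuousLinearMap.norm_id_le
    rw [Complex.norm_real, norm_div, norm_norm]
    exact div_le_one_of_le₀ (PiLp.norm_apply_le (x.toEuclid - a) j) (norm_nonneg _))

/-! ## Tight-binding Hamiltonians, the Fermi level and the Fermi projection -/

/-- `H` is a tight-binding Hamiltonian: it acts by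
`(H φ)_α(x) = ∑_y ∑_β t_{x,y}^{α,β} φ_β(y)` with Hermitian, uniformly bounded hopping amplitudes of
finite range. -/
def IsTightBinding {d M : ℕ} (H : WaveFn d M →L[ℂ] WaveFn d M) : Prop :=
  ∃ t : Site d → Site d → Fin M → Fin M → ℂ,
    (∀ x y α β, t y x β α = starRingEnd ℂ (t x y α β)) ∧
    (∃ t₀ : ℝ, 0 < t₀ ∧ ∀ x y α β, ‖t x y α β‖ ≤ t₀) ∧
    (∃ R : ℝ, ∀ x y, R < ‖x.toEuclid - y.toEuclid‖ → ∀ α β, t x y α β = 0) ∧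
    ∀ (φ : WaveFn d M) (x : Site d) (α : Fin M),
      HasSum (fun y => ∑ β, t x y α β * φ y β) (H φ x α)

/-- The standing assumption on the Fermi level `E`: the resolvent decays exponentially,
`sup_{ε > 0} ‖χ_x (E + i ε - H)⁻¹ χ_y‖ ≤ C₀ exp (-|x - y| / ξ₀)`. -/
def ResolventDecay {d M : ℕ} (H : WaveFn d M →L[ℂ] WaveFn d M) (E : ℝ) : Prop :=
  ∃ C₀ ξ₀ : ℝ, 0 < C₀ ∧ 0 < ξ₀ ∧ ∀ ε : ℝ, 0 < ε → ∀ x y : Site d,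
    ‖siteProj M x ∘L resolvent H ((E : ℂ) + ε * Complex.I) ∘L siteProj M y‖ ≤
      C₀ * Real.exp (-‖x.toEuclid - y.toEuclid‖ / ξ₀)

/-- The spectral projection of a self-adjoint operator `H` onto the states of energy less than `E`,
that is, the orthogonal projection onto the closure of the range of the positive part
`(E - H)₊`. -/
def projBelow {V : Type*} [NormedAddCommGroup V] [InnerProductSpace ℂ V] [CompleteSpace V]
    (H : V →L[ℂ] V) (E : ℝ) : V →L[ℂ] V :=
  (LinearMap.range ((cfc (fun r : ℝ => max (E - r) 0) H : V →L[ℂ] V) :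
    V →ₗ[ℂ] V)).topologicalClosure.starProjection

/-- The Fermi projection of the Hamiltonian `H` at the Fermi level `E`. -/
def fermiProj {d M : ℕ} (H : WaveFn d M →L[ℂ] WaveFn d M) (E : ℝ) :
    WaveFn d M →L[ℂ] WaveFn d M :=
  projBelow H E

/-! ## Gamma matrices -/

/-- The first Pauli matrix. -/
def pauli₁ : Matrix (Fin 2) (Fin 2) ℂ := !![0, 1; 1, 0]
/-- The second Pauli matrix. -/
def pauli₂ : Matrix (Fin 2) (Fin 2) ℂ := !![0, -Complex.I; Complex.I, 0]
/-- The third Pauli matrix. -/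
def pauli₃ : Matrix (Fin 2) (Fin 2) ℂ := !![1, 0; 0, -1]

/-- Index set of the standard basis of `ℂ^{2^n} = ℂ² ⊗ ⋯ ⊗ ℂ²`. -/
abbrev Spin (n : ℕ) : Type := Fin n → Fin 2

/-- The Kronecker product `m 0 ⊗ m 1 ⊗ ⋯ ⊗ m (n - 1)` of `2 × 2` matrices. -/
def kron {n : ℕ} (m : Fin n → Matrix (Fin 2) (Fin 2) ℂ) : Matrix (Spin n) (Spin n) ℂ :=
  Matrix.of fun s s' => ∏ k, m k (s k) (s' k)

/-- The gamma matrices `γ^{(1)}, …, γ^{(2n)}`, numbered from `0`: the factors before position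
`j / 2` are `1`, the factor at `j / 2` is `σ₁` (`j` even) or `σ₂` (`j` odd), and the later ones
are `σ₃`. -/
def gammaMat (n : ℕ) (j : Fin (2 * n)) : Matrix (Spin n) (Spin n) ℂ :=
  kron fun k =>
    if (k : ℕ) < (j : ℕ) / 2 then 1
    else if (k : ℕ) = (j : ℕ) / 2 then (if (j : ℕ) % 2 = 0 then pauli₁ else pauli₂)
    else pauli₃

/-- The last gamma matrix `γ^{(2n+1)} = σ₃ ⊗ ⋯ ⊗ σ₃`. -/
def gammaLast (n : ℕ) : Matrix (Spin n) (Spin n) ℂ := kron fun _ => pauli₃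

/-! ## The Dirac operator and the operator `A` -/

/-- The Hilbert space `ℓ²(ℤ^{2n}, ℂ^M) ⊗ ℂ^{2^n}`, as the Hilbert sum of `2^n` copies of
`ℓ²(ℤ^{2n}, ℂ^M)`. -/
abbrev SpinWaveFn (n M : ℕ) : Type := PiLp 2 (fun _ : Spin n => WaveFn (2 * n) M)

/-- The operator `T ⊗ g`, that is, `((T ⊗ g) φ)_s = ∑_{s'} g_{s s'} T φ_{s'}`. -/
def tensorOp {n M : ℕ} (T : WaveFn (2 * n) M →L[ℂ] WaveFn (2 * n) M)
    (g : Matrix (Spin n) (Spin n) ℂ) : SpinWaveFn n M →L[ℂ] SpinWaveFn n M :=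
  (PiLp.continuousLinearEquiv 2 ℂ (fun _ : Spin n => WaveFn (2 * n) M)).symm.toContinuousLinearMap
    ∘L ContinuousLinearMap.pi (fun s => ∑ s', g s s' • (T ∘L ContinuousLinearMap.proj s'))
    ∘L (PiLp.continuousLinearEquiv 2 ℂ
      (fun _ : Spin n => WaveFn (2 * n) M)).toContinuousLinearMap

/-- The Dirac operator `D_a = ∑_j ((x^{(j)} - a^{(j)}) / |x - a|) γ^{(j)}`. -/
def dirac (n M : ℕ) (a : EuclideanSpace ℝ (Fin (2 * n))) : SpinWaveFn n M →L[ℂ] SpinWaveFn n M :=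
  ∑ j, tensorOp (unitPosition M a j) (gammaMat n j)

/-- The operator `1 ⊗ γ^{(2n+1)}`. -/
def grading (n M : ℕ) : SpinWaveFn n M →L[ℂ] SpinWaveFn n M :=
  tensorOp 1 (gammaLast n)

/-- The operator `A = γ^{(2n+1)} (P - D_a P D_a)`, where `P` is the Fermi projection, identified
with `P ⊗ 1`. -/
def opA {n M : ℕ} (a : EuclideanSpace ℝ (Fin (2 * n)))
    (H : WaveFn (2 * n) M →L[ℂ] WaveFn (2 * n) M) (E : ℝ) :
    SpinWaveFn n M →L[ℂ] SpinWaveFn n M :=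
  grading n M * (tensorOp (fermiProj H E) 1 - dirac n M a * tensorOp (fermiProj H E) 1 * dirac n M a)

/-- The kernel of `A - c`. -/
def kerA {n M : ℕ} (a : EuclideanSpace ℝ (Fin (2 * n)))
    (H : WaveFn (2 * n) M →L[ℂ] WaveFn (2 * n) M) (E : ℝ) (c : ℝ) :
    Submodule ℂ (SpinWaveFn n M) :=
  LinearMap.ker ((opA a H E - (c : ℂ) • 1 : SpinWaveFn n M →L[ℂ] SpinWaveFn n M) :
    SpinWaveFn n M →ₗ[ℂ] SpinWaveFn n M)

/-- The kernel of `A - c` inside the subspace `γ^{(2n+1)} = 1`; there `A` is the block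
`P - 𝔇_a* P 𝔇_a`. -/
def kerBlock {n M : ℕ} (a : EuclideanSpace ℝ (Fin (2 * n)))
    (H : WaveFn (2 * n) M →L[ℂ] WaveFn (2 * n) M) (E : ℝ) (c : ℝ) :
    Submodule ℂ (SpinWaveFn n M) :=
  kerA a H E c ⊓ LinearMap.ker ((grading n M - 1 : SpinWaveFn n M →L[ℂ] SpinWaveFn n M) :
    SpinWaveFn n M →ₗ[ℂ] SpinWaveFn n M)

/-- The integer-valued index `½ {dim ker (A - 1) - dim ker (A + 1)}`. -/
def integerIndex {n M : ℕ} (a : EuclideanSpace ℝ (Fin (2 * n)))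
    (H : WaveFn (2 * n) M →L[ℂ] WaveFn (2 * n) M) (E : ℝ) : ℚ :=
  (1 / 2) * ((Module.finrank ℂ (kerA a H E 1) : ℚ) - Module.finrank ℂ (kerA a H E (-1)))

/-- The `ℤ₂` index `½ dim ker (A - 1)` modulo `2`. -/
def z2Index {n M : ℕ} (a : EuclideanSpace ℝ (Fin (2 * n)))
    (H : WaveFn (2 * n) M →L[ℂ] WaveFn (2 * n) M) (E : ℝ) : ZMod 2 :=
  ((Module.finrank ℂ (kerA a H E 1) / 2 : ℕ) : ZMod 2)

/-! ## Symmetry classes and the periodic table -/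

/-- The ten Cartan-Altland-Zirnbauer classes. -/
inductive CAZClass : Type
  | A | AIII | AI | BDI | D | DIII | AII | CII | C | CI

/-- Time-reversal symmetry of a class: `1` even, `-1` odd, `0` absent. -/
def CAZClass.trs : CAZClass → ℤ
  | A => 0 | AIII => 0 | AI => 1 | BDI => 1 | D => 0 | DIII => -1 | AII => -1 | CII => -1
  | C => 0 | CI => 1

/-- Particle-hole symmetry of a class: `1` even, `-1` odd, `0` absent. -/
def CAZClass.phs : CAZClass → ℤ
  | A => 0 | AIII => 0 | AI => 0 | BDI => 1 | D => 1 | DIII => 1 | AII => 0 | CII => -1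
  | C => -1 | CI => -1

/-- Chiral symmetry of a class: `1` present, `0` absent. -/
def CAZClass.chs : CAZClass → ℤ
  | A => 0 | AIII => 1 | AI => 0 | BDI => 1 | D => 0 | DIII => 1 | AII => 0 | CII => 1
  | C => 0 | CI => 1

/-- The entries of the periodic table: no index, or an index in `ℤ`, `2ℤ` or `ℤ₂`. -/
inductive TableEntry : Type
  | none | Z | twoZ | Z2

open TableEntry in
/-- The rows of the periodic table; the columns are the dimensions `d = 1, …, 8`. -/
def tableRow : CAZClass → Fin 8 → TableEntry
  | .A    => ![none, Z,    none, Z,    none, Z,    none, Z]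
  | .AIII => ![Z,    none, Z,    none, Z,    none, Z,    none]
  | .AI   => ![none, none, none, twoZ, none, Z2,   Z2,   Z]
  | .BDI  => ![Z,    none, none, none, twoZ, none, Z2,   Z2]
  | .D    => ![Z2,   Z,    none, none, none, twoZ, none, Z2]
  | .DIII => ![Z2,   Z2,   Z,    none, none, none, twoZ, none]
  | .AII  => ![none, Z2,   Z2,   Z,    none, none, none, twoZ]
  | .CII  => ![twoZ, none, Z2,   Z2,   Z,    none, none, none]
  | .C    => ![none, twoZ, none, Z2,   Z2,   Z,    none, none]
  | .CI   => ![none, none, twoZ, none, Z2,   Z2,   Z,    none]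

/-- The entry of the periodic table in dimension `d ≥ 1`; the table has period `8` in `d`. -/
def periodicTable (c : CAZClass) (d : ℕ) : TableEntry := tableRow c (Fin.ofNat 8 (d - 1))

/-- Symmetry operators of the type that class `c` prescribes on `ℓ²(ℤ^d, ℂ^M)`. The time-reversal
and particle-hole transformations are `φ ↦ U (conj φ)` with a unitary matrix `U` on the internal
space, and square to `1` (even) or to `-1` (odd); the chiral operator is self-adjoint with
square `1`. An operator whose symmetry is absent in the class is irrelevant. -/
structure SymmetryOps (c : CAZClass) (d M : ℕ) where
  /-- The matrix of the time-reversal transformation. -/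
  timeRev : Matrix (Fin M) (Fin M) ℂ
  /-- The matrix of the particle-hole transformation. -/
  partHole : Matrix (Fin M) (Fin M) ℂ
  /-- The chiral operator. -/
  chiral : WaveFn d M →L[ℂ] WaveFn d M
  timeRev_unitary : c.trs ≠ 0 → timeRev ∈ Matrix.unitaryGroup (Fin M) ℂ
  timeRev_sq : c.trs ≠ 0 →
    ∀ φ : WaveFn d M, antiOp timeRev (antiOp timeRev φ) = (c.trs : ℂ) • φ
  partHole_unitary : c.phs ≠ 0 → partHole ∈ Matrix.unitaryGroup (Fin M) ℂ
  partHole_sq : c.phs ≠ 0 →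
    ∀ φ : WaveFn d M, antiOp partHole (antiOp partHole φ) = (c.phs : ℂ) • φ
  chiral_selfAdjoint : c.chs ≠ 0 → IsSelfAdjoint chiral
  chiral_sq : c.chs ≠ 0 → chiral * chiral = 1

/-- The Hamiltonian `H` has the symmetries of the class: `Θ H = H Θ`, `Ξ H = - H Ξ` and
`S H S = - H`, as far as the class has them. -/
def SymmetryOps.Preserves {c : CAZClass} {d M : ℕ} (S : SymmetryOps c d M)
    (H : WaveFn d M →L[ℂ] WaveFn d M) : Prop :=
  (c.trs ≠ 0 → ∀ φ : WaveFn d M, antiOp S.timeRev (H φ) = H (antiOp S.timeRev φ)) ∧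
  (c.phs ≠ 0 → ∀ φ : WaveFn d M, antiOp S.partHole (H φ) = -H (antiOp S.partHole φ)) ∧
  (c.chs ≠ 0 → S.chiral * H * S.chiral = -H)

end TopIns

end

open TopIns

noncomputable section

namespace TopIns

open scoped InnerProductSpace
open Filter Topology

/-! ## Block matrix elements on the lattice -/

/-! The Fermi level lies in a spectral gap. Exponential decay of the resolvent blocks and the Schur
test (`norm_le_of_block_le`) bound the resolvent uniformly in `ε`, and for self-adjoint `H` a
Neumann series then puts `E` in the resolvent set. On the spectrum the step function is therefore
continuous, and the Fermi projection `P` is a continuous function of `H` (`projBelow_eq_cfc`).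
Closed star subalgebras carry three properties from `H` to `P`: compact commutators with the
position directions, norm continuity in `H`, and intertwining relations with antilinear symmetries.

Write `γ` for the grading, `D` for the Dirac operator, `Q = D P D`, `A = γ (P - Q)` and `B = 1 - P -
Q`. Then `A = γ D (D P - P D)` is compact and self-adjoint, `A² + B² = 1` and `A B = -B A`. Moreover
`D` commutes with `A` and anticommutes with `γ`, so every eigenspace of `A` at a nonzero eigenvalue
has equal parts in `γ = 1` and `γ = -1`.

Combining the symmetry with a conjugation of the spinors gives an antilinear `T`, and for the `ℤ₂`
entries of the table the signs work out to `T² = 1` (`periodicTable_even_Z2`). For odd `n` time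
reversal makes `T` commute with `P` and anticommute with `D` and `γ`; for even `n` particle-hole
symmetry makes `T` exchange `P` with `1 - P` and commute with `D` and `γ`. In both cases `T A = -A
T`, so `λ` and `-λ` have equal multiplicities and the integer index vanishes.

The map `X = T D B` (odd `n`) or `X = T B` (even `n`) is antilinear, commutes with `A` and `γ`, and
satisfies `X² = -B² = -(1 - A²)`. This is negative on eigenspaces with `|λ| < 1`, so Kramers
degeneracy makes each block there even-dimensional and the full multiplicity divisible by 4. No
eigenvalue exceeds 1, and the total multiplicity near 1 is stable under small perturbations
(`exists_finrank_upperEigen_eq`). Eigenvalues leave 1 only in groups of total multiplicity divisible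
by 4, so half the dimension of `ker (A - 1)` is locally constant modulo 2. -/

@[simp]
theorem fiberOp_apply {d M : ℕ}
    (T : Site d → (EuclideanSpace ℂ (Fin M) →L[ℂ] EuclideanSpace ℂ (Fin M)))
    (C : ℝ) (hC : ∀ x, ‖T x‖ ≤ C) (φ : WaveFn d M) (x : Site d) :
    fiberOp T C hC φ x = T x (φ x) := rfl

theorem siteProj_eq_single {d M : ℕ} (x : Site d) (φ : WaveFn d M) :
    siteProj M x φ = lp.single 2 x (φ x) := by
  ext y : 2
  by_cases h : y = x
  · subst h; simp [siteProj]
  · simp [siteProj, h]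

theorem hasSum_siteProj {d M : ℕ} (φ : WaveFn d M) : HasSum (fun x => siteProj M x φ) φ := by
  simp only [siteProj_eq_single]
  exact lp.hasSum_single (by norm_num) φ

theorem norm_single_wave {d M : ℕ} (x : Site d) (v : EuclideanSpace ℂ (Fin M)) :
    ‖(lp.single 2 x v : WaveFn d M)‖ = ‖v‖ :=
  lp.norm_single (E := fun _ : Site d => EuclideanSpace ℂ (Fin M)) (p := 2) two_pos x v

theorem norm_block_apply_le {d M : ℕ} (T : WaveFn d M →L[ℂ] WaveFn d M) (x y : Site d)
    (w : EuclideanSpace ℂ (Fin M)) :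
    ‖T (lp.single 2 y w) x‖ ≤ ‖siteProj M x ∘L T ∘L siteProj M y‖ * ‖w‖ := by
  have h2 := (siteProj M x ∘L T ∘L siteProj M y).le_opNorm (lp.single 2 y w)
  simpa only [ContinuousLinearMap.comp_apply, siteProj_eq_single, lp.single_apply_self,
    norm_single_wave] using h2

theorem norm_inner_single_le {d M : ℕ} (T : WaveFn d M →L[ℂ] WaveFn d M) (x y : Site d)
    (v w : EuclideanSpace ℂ (Fin M)) :
    ‖⟪(lp.single 2 x v : WaveFn d M), T (lp.single 2 y w)⟫_ℂ‖ ≤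
      ‖siteProj M x ∘L T ∘L siteProj M y‖ * (‖v‖ * ‖w‖) := by
  rw [lp.inner_single_left]
  refine (norm_inner_le_norm _ _).trans ?_
  have h := mul_le_mul_of_nonneg_left (norm_block_apply_le T x y w) (norm_nonneg v)
  linarith

/-! ### The Schur test. -/

theorem sum_sq_norm_le {d M : ℕ} (φ : WaveFn d M) (s : Finset (Site d)) :
    ∑ x ∈ s, ‖φ x‖ ^ 2 ≤ ‖φ‖ ^ 2 := by
  have h2 : (0 : ℝ) < (2 : ℝ≥0∞).toReal := by norm_num
  simpa using lp.sum_rpow_le_norm_rpow h2 φ s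

/-- The arithmetic-geometric mean inequality separates `f` from `g`; what remains are row and column
sums of `k (x - y)`, each bounded by the full sum of `k` because reflections and translations
permute the group. -/
theorem sum_convolution_le {G : Type*} [AddCommGroup G] {k : G → ℝ} (hk : Summable k)
    (hk0 : ∀ v, 0 ≤ k v) (s : Finset G) (f g : G → ℝ) :
    ∑ x ∈ s, ∑ y ∈ s, k (x - y) * (f x * g y) ≤
      (∑' v, k v) / 2 * (∑ x ∈ s, f x ^ 2 + ∑ y ∈ s, g y ^ 2) := by
  set K := ∑' v, k v with hK
  have hrow : ∀ x, ∑ y ∈ s, k (x - y) ≤ K := by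
    intro x
    have h1 : Summable fun y => k (x - y) := (Equiv.subLeft x).summable_iff.mpr hk
    calc _ ≤ ∑' y, k (x - y) := h1.sum_le_tsum s (fun _ _ => hk0 _)
      _ = K := (Equiv.subLeft x).tsum_eq k
  have hcol : ∀ y, ∑ x ∈ s, k (x - y) ≤ K := by
    intro y
    have h1 : Summable fun x => k (x - y) := (Equiv.subRight y).summable_iff.mpr hk
    calc _ ≤ ∑' x, k (x - y) := h1.sum_le_tsum s (fun _ _ => hk0 _)
      _ = K := (Equiv.subRight y).tsum_eq k
  calc ∑ x ∈ s, ∑ y ∈ s, k (x - y) * (f x * g y)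
      ≤ ∑ x ∈ s, ∑ y ∈ s, (k (x - y) * (f x ^ 2 / 2) + k (x - y) * (g y ^ 2 / 2)) := by
        refine Finset.sum_le_sum fun x _ => Finset.sum_le_sum fun y _ => ?_
        nlinarith [mul_nonneg (hk0 (x - y)) (sq_nonneg (f x - g y))]
    _ = ∑ x ∈ s, (∑ y ∈ s, k (x - y)) * (f x ^ 2 / 2) +
          ∑ y ∈ s, (∑ x ∈ s, k (x - y)) * (g y ^ 2 / 2) := by
        simp only [Finset.sum_add_distrib, Finset.sum_mul]
        congr 1
        exact Finset.sum_comm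
    _ ≤ ∑ x ∈ s, K * (f x ^ 2 / 2) + ∑ y ∈ s, K * (g y ^ 2 / 2) := by
        gcongr with x _ y _
        · exact hrow x
        · exact hcol y
    _ = _ := by
        rw [← Finset.mul_sum, ← Finset.mul_sum, ← Finset.sum_div, ← Finset.sum_div]
        ring

/-- The Schur test: an operator whose blocks are dominated by a summable convolution kernel. -/
theorem norm_le_of_block_le {d M : ℕ} (T : WaveFn d M →L[ℂ] WaveFn d M) (k : Site d → ℝ)
    (hk : Summable k) (h : ∀ x y, ‖siteProj M x ∘L T ∘L siteProj M y‖ ≤ k (x - y)) :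
    ‖T‖ ≤ ∑' v, k v := by
  have hk0 : ∀ v, 0 ≤ k v := fun v => by simpa using (norm_nonneg _).trans (h v 0)
  have hK0 : 0 ≤ ∑' v, k v := tsum_nonneg hk0
  have hxy : ∀ (φ ψ : WaveFn d M) (x y : Site d),
      ‖⟪siteProj M x ψ, T (siteProj M y φ)⟫_ℂ‖ ≤ k (x - y) * (‖ψ x‖ * ‖φ y‖) := by
    intro φ ψ x y
    rw [siteProj_eq_single, siteProj_eq_single]
    exact (norm_inner_single_le T x y _ _).trans (mul_le_mul_of_nonneg_right (h x y)
      (mul_nonneg (norm_nonneg _) (norm_nonneg _)))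
  -- Truncation to finitely many sites avoids any question of convergence of the double sum; the
  -- bound is uniform in `s` and passes to the limit.
  have hfin : ∀ (φ ψ : WaveFn d M) (s : Finset (Site d)),
      ‖⟪∑ x ∈ s, siteProj M x ψ, T (∑ y ∈ s, siteProj M y φ)⟫_ℂ‖ ≤
        (∑' v, k v) / 2 * (‖ψ‖ ^ 2 + ‖φ‖ ^ 2) := by
    intro φ ψ s
    rw [map_sum, sum_inner]
    simp_rw [inner_sum]
    refine (norm_sum_le _ _).trans ((Finset.sum_le_sum fun x _ => (norm_sum_le _ _).trans
      (Finset.sum_le_sum fun y _ => hxy φ ψ x y)).trans ?_)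
    refine (sum_convolution_le hk hk0 s (fun x => ‖ψ x‖) (fun y => ‖φ y‖)).trans ?_
    exact mul_le_mul_of_nonneg_left (add_le_add (sum_sq_norm_le ψ s) (sum_sq_norm_le φ s))
      (by positivity)
  have hlim : ∀ φ ψ : WaveFn d M,
      ‖⟪ψ, T φ⟫_ℂ‖ ≤ (∑' v, k v) / 2 * (‖ψ‖ ^ 2 + ‖φ‖ ^ 2) := by
    intro φ ψ
    have h1 : Tendsto (fun s : Finset (Site d) => ∑ x ∈ s, siteProj M x ψ) atTop (𝓝 ψ) :=
      hasSum_siteProj ψ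
    have h2 : Tendsto (fun s : Finset (Site d) => T (∑ x ∈ s, siteProj M x φ)) atTop (𝓝 (T φ)) :=
      (T.continuous.tendsto φ).comp (hasSum_siteProj φ)
    exact le_of_tendsto (h1.inner h2).norm (Eventually.of_forall fun s => hfin φ ψ s)
  generalize (∑' v, k v) = K at hK0 hlim
  refine ContinuousLinearMap.opNorm_le_of_unit_norm hK0 fun φ hφ => ?_
  by_cases h0 : T φ = 0
  · simpa [h0] using hK0
  have hpos : 0 < ‖T φ‖ := norm_pos_iff.mpr h0
  -- Both test vectors are now unit vectors, so the quadratic bound `K / 2 * (1 + 1)` becomes the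
  -- linear bound `‖T φ‖ ≤ K`.
  have h1 := hlim φ ((‖T φ‖⁻¹ : ℂ) • T φ)
  rw [inner_smul_left, inner_self_eq_norm_sq_to_K, norm_smul, hφ] at h1
  simp only [norm_mul, norm_inv, RCLike.norm_conj, Complex.norm_real, norm_norm,
    norm_pow, map_inv₀, Complex.coe_algebraMap] at h1
  field_simp at h1
  linarith

theorem norm_siteProj_le {d M : ℕ} (x : Site d) : ‖siteProj M x‖ ≤ 1 := by
  refine ContinuousLinearMap.opNorm_le_bound _ zero_le_one fun φ => ?_
  rw [siteProj_eq_single, norm_single_wave, one_mul]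
  exact lp.norm_apply_le_norm two_ne_zero φ x

theorem norm_block_le {d M : ℕ} (T : WaveFn d M →L[ℂ] WaveFn d M) (x y : Site d) :
    ‖siteProj M x ∘L T ∘L siteProj M y‖ ≤ ‖T‖ := by
  refine (ContinuousLinearMap.opNorm_comp_le _ _).trans ?_
  refine (mul_le_mul (norm_siteProj_le x) (ContinuousLinearMap.opNorm_comp_le _ _)
    (norm_nonneg _) zero_le_one).trans ?_
  rw [one_mul]
  exact mul_le_of_le_one_right (norm_nonneg _) (norm_siteProj_le y)

theorem ext_single {d M : ℕ} {S T : WaveFn d M →L[ℂ] WaveFn d M}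
    (h : ∀ x y α β, S (lp.single 2 y (EuclideanSpace.single β (1 : ℂ))) x α =
      T (lp.single 2 y (EuclideanSpace.single β (1 : ℂ))) x α) : S = T := by
  have h1 : ∀ y (w : EuclideanSpace ℂ (Fin M)), S (lp.single 2 y w) = T (lp.single 2 y w) := by
    intro y w
    have : (S ∘L lp.singleContinuousLinearMap ℂ (fun _ : Site d => EuclideanSpace ℂ (Fin M)) 2 y
        : EuclideanSpace ℂ (Fin M) →ₗ[ℂ] WaveFn d M) =
        (T ∘L lp.singleContinuousLinearMap ℂ (fun _ : Site d => EuclideanSpace ℂ (Fin M)) 2 y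
        : EuclideanSpace ℂ (Fin M) →ₗ[ℂ] WaveFn d M) := by
      refine (EuclideanSpace.basisFun (Fin M) ℂ).toBasis.ext fun β => ?_
      ext x α
      simpa using h x y α β
    exact LinearMap.congr_fun this w
  ext φ : 1
  have h2 := (hasSum_siteProj φ).mapL S
  have h3 := (hasSum_siteProj φ).mapL T
  simp only [siteProj_eq_single, h1] at h2 h3
  exact h2.unique h3

/-! ## Tight-binding Hamiltonians -/

/-- The blocks of `T` vanish beyond the distance `R`. -/
def HasRange {d M : ℕ} (T : WaveFn d M →L[ℂ] WaveFn d M) (R : ℝ) : Prop :=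
  ∀ x y : Site d, R < ‖x.toEuclid - y.toEuclid‖ → siteProj M x ∘L T ∘L siteProj M y = 0

theorem hopping_apply {d M : ℕ} {H : WaveFn d M →L[ℂ] WaveFn d M}
    {t : Site d → Site d → Fin M → Fin M → ℂ}
    (ht : ∀ (φ : WaveFn d M) (x : Site d) (α : Fin M),
      HasSum (fun y => ∑ β, t x y α β * φ y β) (H φ x α))
    (x y : Site d) (w : EuclideanSpace ℂ (Fin M)) (α : Fin M) :
    H (lp.single 2 y w) x α = ∑ β, t x y α β * w β := by
  refine (ht (lp.single 2 y w) x α).unique ?_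
  have := hasSum_single (f := fun z => ∑ β, t x z α β * (lp.single 2 y w : WaveFn d M) z β) y
    (fun z hz => by simp [hz])
  simpa using this

theorem IsTightBinding.isSelfAdjoint {d M : ℕ} {H : WaveFn d M →L[ℂ] WaveFn d M}
    (hH : IsTightBinding H) : IsSelfAdjoint H := by
  obtain ⟨t, hherm, -, -, ht⟩ := hH
  refine ext_single fun x y α β => ?_
  have h1 : ∀ (T : WaveFn d M →L[ℂ] WaveFn d M),
      T (lp.single 2 y (EuclideanSpace.single β (1 : ℂ))) x α =
      ⟪(lp.single 2 x (EuclideanSpace.single α (1 : ℂ)) : WaveFn d M),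
        T (lp.single 2 y (EuclideanSpace.single β (1 : ℂ)))⟫_ℂ := by
    intro T
    simp [lp.inner_single_left, EuclideanSpace.inner_single_left]
  have h2 : H (lp.single 2 y (EuclideanSpace.single β (1 : ℂ))) x α = t x y α β := by
    rw [hopping_apply ht]; simp
  have h3 : H (lp.single 2 x (EuclideanSpace.single α (1 : ℂ))) y β = t y x β α := by
    rw [hopping_apply ht]; simp
  rw [h2, h1, ContinuousLinearMap.star_eq_adjoint, ContinuousLinearMap.adjoint_inner_right,
    lp.inner_single_right]
  simp [EuclideanSpace.inner_single_right, h3, hherm x y α β]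

theorem IsTightBinding.exists_hasRange {d M : ℕ} {H : WaveFn d M →L[ℂ] WaveFn d M}
    (hH : IsTightBinding H) : ∃ R, HasRange H R := by
  obtain ⟨t, -, -, ⟨R, hR⟩, ht⟩ := hH
  refine ⟨R, fun x y hxy => ?_⟩
  ext φ : 1
  have : H (lp.single 2 y (φ y)) x = 0 := by
    ext α
    simp [hopping_apply ht, hR x y hxy]
  simp [siteProj_eq_single, this]

/-! ## The spectral gap -/

theorem toEuclid_sub {d : ℕ} (x y : Site d) :
    Site.toEuclid (x - y) = x.toEuclid - y.toEuclid := by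
  ext i; simp [Site.toEuclid]

theorem finite_setOf_norm_sub_le {d : ℕ} (a : EuclideanSpace ℝ (Fin d)) (ρ : ℝ) :
    {x : Site d | ‖x.toEuclid - a‖ ≤ ρ}.Finite := by
  refine (Set.finite_Icc (fun i => ⌊a i - ρ⌋) (fun i => ⌈a i + ρ⌉)).subset fun x hx => ?_
  have hi : ∀ i, ‖(x i : ℝ) - a i‖ ≤ ρ := fun i =>
    (PiLp.norm_apply_le (Site.toEuclid x - a) i).trans hx
  refine ⟨fun i => ?_, fun i => ?_⟩
  · have := (abs_le.mp (hi i)).1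
    show ⌊a i - ρ⌋ ≤ x i
    exact (Int.cast_le (R := ℝ)).mp ((Int.floor_le _).trans (by linarith))
  · have := (abs_le.mp (hi i)).2
    show x i ≤ ⌈a i + ρ⌉
    exact (Int.cast_le (R := ℝ)).mp (le_trans (by linarith) (Int.le_ceil _))

theorem summable_exp_neg_norm {d : ℕ} {ξ : ℝ} (hξ : 0 < ξ) :
    Summable fun v : Site d => Real.exp (-‖v.toEuclid‖ / ξ) := by
  -- Since `∑ |v i| ≤ d ‖v‖`, the exponential is dominated by a product of one-dimensional geometric
  -- series; `d + 1` in place of `d` keeps `c` meaningful for `d = 0`.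
  set c : ℝ := 1 / (ξ * (d + 1)) with hc
  have hc0 : 0 < c := by positivity
  have h1 : Summable fun m : ℤ => Real.exp (-|(m : ℝ)| * c) := by
    have hn : Summable fun m : ℕ => Real.exp (-(m : ℝ) * c) := by
      have := Real.summable_exp_nat_mul_iff.mpr (neg_lt_zero.mpr hc0)
      refine this.congr fun m => by congr 1; ring
    refine Summable.of_nat_of_neg (hn.congr fun m => by simp) (hn.congr fun m => by simp)
  refine summable_of_sum_le (c := ∏ _i : Fin d, ∑' m : ℤ, Real.exp (-|(m : ℝ)| * c))
    (fun v => (Real.exp_pos _).le) fun s => ?_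
  have hle : ∀ v : Site d,
      Real.exp (-‖v.toEuclid‖ / ξ) ≤ ∏ i, Real.exp (-|(v i : ℝ)| * c) := by
    intro v
    rw [← Real.exp_sum]
    gcongr
    rw [← Finset.sum_mul, Finset.sum_neg_distrib, neg_mul, neg_div, neg_le_neg_iff]
    have h2 : ∑ i, |(v i : ℝ)| ≤ d * ‖v.toEuclid‖ := by
      refine (Finset.sum_le_card_nsmul Finset.univ _ ‖v.toEuclid‖
        (fun i _ => PiLp.norm_apply_le v.toEuclid i)).trans ?_
      simp
    rw [hc, mul_one_div, div_le_div_iff₀ (by positivity) hξ]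
    nlinarith [mul_nonneg hξ.le (norm_nonneg v.toEuclid), mul_le_mul_of_nonneg_right h2 hξ.le]
  let box : Fin d → Finset ℤ := fun i => s.image (fun v => v i)
  have hsub : s ⊆ Fintype.piFinset box := fun v hv =>
    Fintype.mem_piFinset.mpr fun i => Finset.mem_image_of_mem _ hv
  calc ∑ v ∈ s, Real.exp (-‖v.toEuclid‖ / ξ)
      ≤ ∑ v ∈ s, ∏ i, Real.exp (-|(v i : ℝ)| * c) := Finset.sum_le_sum fun v _ => hle v
    _ ≤ ∑ v ∈ Fintype.piFinset box, ∏ i, Real.exp (-|(v i : ℝ)| * c) :=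
        Finset.sum_le_sum_of_subset_of_nonneg hsub
          (fun _ _ _ => Finset.prod_nonneg fun _ _ => (Real.exp_pos _).le)
    _ = ∏ i, ∑ m ∈ box i, Real.exp (-|(m : ℝ)| * c) :=
        (Finset.prod_univ_sum box fun _ m => Real.exp (-|(m : ℝ)| * c)).symm
    _ ≤ _ := Finset.prod_le_prod (fun _ _ => Finset.sum_nonneg fun _ _ => (Real.exp_pos _).le)
        (fun i _ => h1.sum_le_tsum _ (fun _ _ => (Real.exp_pos _).le))

/-- The decaying kernel is summable over the lattice and does not depend on `ε`, so the Schur test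
gives one bound for all `ε`. -/
theorem ResolventDecay.exists_norm_resolvent_le {d M : ℕ} {H : WaveFn d M →L[ℂ] WaveFn d M}
    {E : ℝ} (h : ResolventDecay H E) :
    ∃ K : ℝ, ∀ ε : ℝ, 0 < ε → ‖resolvent H ((E : ℂ) + ε * Complex.I)‖ ≤ K := by
  obtain ⟨C, ξ, hC, hξ, h⟩ := h
  refine ⟨_, fun ε hε => norm_le_of_block_le _
    (fun v => C * Real.exp (-‖v.toEuclid‖ / ξ)) ((summable_exp_neg_norm hξ).mul_left C) fun x y => ?_⟩
  simpa only [toEuclid_sub] using h ε hε x y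

/-- A self-adjoint operator whose resolvent stays bounded as `E` is approached from the upper half
plane has a spectral gap at `E`. -/
theorem notMem_spectrum_of_resolvent_bounded {A : Type*} [CStarAlgebra A] {H : A}
    (hH : IsSelfAdjoint H) {E K : ℝ}
    (h : ∀ ε : ℝ, 0 < ε → ‖resolvent H ((E : ℂ) + ε * Complex.I)‖ ≤ K) :
    (E : ℂ) ∉ spectrum ℂ H := by
  have hK0 : 0 ≤ K := (norm_nonneg _).trans (h 1 one_pos)
  -- With this `ε` the norm of `ε (z - H)⁻¹` is below 1, so `E - H = (z - H) (1 - i ε (z - H)⁻¹)` is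
  -- invertible by a Neumann series.
  set ε : ℝ := 1 / (K + 1) with hε
  have hε0 : 0 < ε := by positivity
  set z : ℂ := (E : ℂ) + ε * Complex.I with hz
  -- `resolvent` takes the value 0 at spectral points, so the norm bound alone says nothing;
  -- self-adjointness makes the non-real `z` a regular point.
  have hu : IsUnit (algebraMap ℂ A z - H) := by
    by_contra hn
    have h1 : z = z.re := hH.mem_spectrum_eq_re hn
    have h2 := congrArg Complex.im h1
    simp [hz] at h2
    exact hε0.ne' h2
  obtain ⟨u, hu⟩ := hu
  have hres : resolvent H z = ↑u⁻¹ := by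
    rw [resolvent, ← hu, Ring.inverse_unit]
  have hsm : ‖((ε * Complex.I : ℂ)) • (↑u⁻¹ : A)‖ < 1 := by
    rw [norm_smul, ← hres]
    have := h ε hε0
    calc ‖(ε * Complex.I : ℂ)‖ * ‖resolvent H z‖ ≤ ε * K := by
          gcongr
          simp [abs_of_pos hε0]
      _ < 1 := by rw [hε]; rw [one_div, inv_mul_lt_iff₀ (by positivity)]; linarith
  have h1 : algebraMap ℂ A E - H = u * (1 - (ε * Complex.I : ℂ) • (↑u⁻¹ : A)) := by
    rw [mul_sub, mul_smul_comm, Units.mul_inv, mul_one, hu, hz, map_add,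
      Algebra.algebraMap_eq_smul_one (ε * Complex.I : ℂ)]
    abel
  intro hmem
  refine hmem ?_
  rw [spectrum.mem_resolventSet_iff, h1]
  exact u.isUnit.mul (isUnit_one_sub_of_norm_lt_one hsm)

/-! ## Compactness of commutators with the position direction -/

/-- The component `(x^{(j)} - a^{(j)}) / |x - a|` of the unit vector pointing from `a` to `x`. -/
def direction {d : ℕ} (a : EuclideanSpace ℝ (Fin d)) (j : Fin d) (x : Site d) : ℝ :=
  (x.toEuclid j - a j) / ‖x.toEuclid - a‖

theorem wave_smul_apply {d M : ℕ} (c : ℂ) (φ : WaveFn d M) (x : Site d) :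
    (c • φ) x = c • φ x := rfl

theorem wave_sub_apply {d M : ℕ} (φ ψ : WaveFn d M) (x : Site d) :
    (φ - ψ) x = φ x - ψ x := rfl

theorem unitPosition_apply {d M : ℕ} (a : EuclideanSpace ℝ (Fin d)) (j : Fin d)
    (φ : WaveFn d M) (x : Site d) : unitPosition M a j φ x = (direction a j x : ℂ) • φ x := rfl

/-- Directions vary slowly far from the origin. Only `X` has to be nonzero: for `Y = 0` the quotient
`Y j / ‖Y‖` is 0. -/
theorem abs_div_norm_sub_div_norm_le {d : ℕ} (X Y : EuclideanSpace ℝ (Fin d)) (hX : 0 < ‖X‖)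
    (j : Fin d) : |X j / ‖X‖ - Y j / ‖Y‖| ≤ 2 * ‖X - Y‖ / ‖X‖ := by
  have h1 : |X j - Y j| ≤ ‖X - Y‖ := PiLp.norm_apply_le (X - Y) j
  have hYj : |Y j| ≤ ‖Y‖ := PiLp.norm_apply_le Y j
  rcases (norm_nonneg Y).eq_or_lt with hY | hY
  · have : Y = 0 := norm_eq_zero.mp hY.symm
    subst this
    have hXj : |X j| ≤ ‖X‖ := PiLp.norm_apply_le X j
    simp only [PiLp.zero_apply, zero_div, sub_zero, abs_div, abs_norm]
    gcongr
    linarith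
  · have h2 : |‖Y‖ - ‖X‖| ≤ ‖X - Y‖ := by
      rw [norm_sub_rev]; exact abs_norm_sub_norm_le Y X
    have h3 : X j / ‖X‖ - Y j / ‖Y‖ = ((X j - Y j) + Y j / ‖Y‖ * (‖Y‖ - ‖X‖)) / ‖X‖ := by
      field_simp
      ring
    have h4 : |Y j / ‖Y‖| ≤ 1 := by
      rw [abs_div, abs_norm]; exact div_le_one_of_le₀ hYj hY.le
    rw [h3, abs_div, abs_norm]
    gcongr
    refine (abs_add_le _ _).trans ?_
    rw [abs_mul]
    have := mul_le_mul h4 h2 (abs_nonneg _) zero_le_one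
    linarith

theorem abs_direction_sub_le {d : ℕ} (a : EuclideanSpace ℝ (Fin d)) (j : Fin d) (x y : Site d)
    (hx : 0 < ‖x.toEuclid - a‖) :
    |direction a j x - direction a j y| ≤
      2 * ‖x.toEuclid - y.toEuclid‖ / ‖x.toEuclid - a‖ := by
  have := abs_div_norm_sub_div_norm_le (x.toEuclid - a) (y.toEuclid - a) hx j
  rwa [sub_sub_sub_cancel_right] at this

/-- The operator factors through the finite-dimensional fibre `ℂ^M`. -/
theorem isCompactOperator_siteProj {d M : ℕ} (x : Site d) : IsCompactOperator (siteProj M x) := by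
  have h1 : IsCompactOperator (lp.evalCLM ℂ (fun _ : Site d => EuclideanSpace ℂ (Fin M)) 2 x) :=
    ((isCompactOperator_id_iff_finiteDimensional (𝕜 := ℂ) (E := EuclideanSpace ℂ (Fin M))).mpr
      inferInstance).comp_clm (lp.evalCLM ℂ (fun _ : Site d => EuclideanSpace ℂ (Fin M)) 2 x)
  have h2 := h1.clm_comp
    (lp.singleContinuousLinearMap ℂ (fun _ : Site d => EuclideanSpace ℂ (Fin M)) 2 x)
  have h3 : (siteProj M x : WaveFn d M → WaveFn d M) =
      lp.singleContinuousLinearMap ℂ (fun _ : Site d => EuclideanSpace ℂ (Fin M)) 2 x ∘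
        lp.evalCLM ℂ (fun _ : Site d => EuclideanSpace ℂ (Fin M)) 2 x :=
    funext fun φ => siteProj_eq_single x φ
  rw [h3]
  exact h2

/-- `unitPosition` is a scalar on each site, so the commutator weights the block of `H` by the
difference of the two scalars. -/
theorem block_commutator {d M : ℕ} (H : WaveFn d M →L[ℂ] WaveFn d M)
    (a : EuclideanSpace ℝ (Fin d)) (j : Fin d) (x y : Site d) :
    siteProj M x ∘L (unitPosition M a j * H - H * unitPosition M a j) ∘L siteProj M y =
      ((direction a j x - direction a j y : ℝ) : ℂ) • (siteProj M x ∘L H ∘L siteProj M y) := by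
  have h1 : ∀ w : EuclideanSpace ℂ (Fin M), unitPosition M a j (lp.single 2 y w) =
      (direction a j y : ℂ) • (lp.single 2 y w : WaveFn d M) := by
    intro w
    ext z : 2
    rw [unitPosition_apply, wave_smul_apply]
    by_cases hz : z = y
    · subst hz; rfl
    · rw [lp.single_apply_ne _ _ _ hz, smul_zero, smul_zero]
  ext φ : 1
  have h2 : (siteProj M x ∘L (unitPosition M a j * H - H * unitPosition M a j) ∘L siteProj M y) φ =
      siteProj M x (unitPosition M a j (H (siteProj M y φ)) -
        H (unitPosition M a j (siteProj M y φ))) := rfl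
  have h3 : (((direction a j x - direction a j y : ℝ) : ℂ) •
      (siteProj M x ∘L H ∘L siteProj M y)) φ =
      ((direction a j x - direction a j y : ℝ) : ℂ) • siteProj M x (H (siteProj M y φ)) := rfl
  rw [h2, h3, siteProj_eq_single y, h1, map_smul, siteProj_eq_single x, siteProj_eq_single x,
    ← lp.single_smul, wave_sub_apply, wave_smul_apply, unitPosition_apply, ← sub_smul,
    Complex.ofReal_sub]

theorem HasRange.isCompactOperator_commutator {d M : ℕ} {H : WaveFn d M →L[ℂ] WaveFn d M} {R : ℝ}
    (hH : HasRange H R) (a : EuclideanSpace ℝ (Fin d)) (j : Fin d) :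
    IsCompactOperator (unitPosition M a j * H - H * unitPosition M a j) := by
  set K := unitPosition M a j * H - H * unitPosition M a j with hK
  -- The Schur kernel is a multiple of this finitely supported indicator, whose sum `N` counts the
  -- lattice vectors within the range.
  let ind : Site d → ℝ := fun v => if ‖v.toEuclid‖ ≤ R then 1 else 0
  have hind0 : ∀ v, 0 ≤ ind v := fun v => by dsimp only [ind]; split_ifs <;> norm_num
  have hfs : Function.HasFiniteSupport ind := by
    refine (finite_setOf_norm_sub_le (0 : EuclideanSpace ℝ (Fin d)) R).subset fun v hv => ?_
    by_contra hn
    simp only [Set.mem_ofPred_eq, sub_zero] at hn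
    exact hv (if_neg hn)
  have hsum : Summable ind := summable_of_hasFiniteSupport hfs
  set N := ∑' v, ind v with hN
  have hN0 : 0 ≤ N := tsum_nonneg hind0
  have hcl : IsClosed {T : WaveFn d M →L[ℂ] WaveFn d M | IsCompactOperator T} :=
    isClosed_setOfPred_isCompactOperator
  refine hcl.closure_subset (Metric.mem_closure_iff.mpr fun ε hε => ?_)
  -- The Schur bound of the part outside the ball of radius `ρ` about `a` is `2 |R| ‖H‖ N / ρ`; this
  -- radius makes it less than `ε`. Inside the ball `Q * K` is compact, so `K` is a norm limit of
  -- compact operators.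
  set ρ : ℝ := 2 * |R| * ‖H‖ * N / ε + 1 with hρ
  have hρ0 : 0 < ρ := by positivity
  let F : Finset (Site d) := (finite_setOf_norm_sub_le a ρ).toFinset
  have hF : ∀ x, x ∈ F ↔ ‖x.toEuclid - a‖ ≤ ρ := fun x => by simp [F]
  let Q : WaveFn d M →L[ℂ] WaveFn d M := ∑ x ∈ F, siteProj M x
  have hQ : IsCompactOperator (Q : WaveFn d M →L[ℂ] WaveFn d M) := by
    show Q ∈ compactOperator (RingHom.id ℂ) (WaveFn d M) (WaveFn d M)
    exact sum_mem fun x _ => isCompactOperator_siteProj x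
  have hQx : ∀ x, siteProj M x * Q = if x ∈ F then siteProj M x else 0 := by
    intro x
    rw [Finset.mul_sum]
    have h0 : ∀ y, siteProj M x * siteProj M y = if y = x then siteProj M x else 0 := by
      intro y
      ext φ : 1
      show siteProj M x (siteProj M y φ) = _
      rw [siteProj_eq_single, siteProj_eq_single]
      split_ifs with h
      · subst h; rw [siteProj_eq_single, lp.single_apply_self]
      · rw [lp.single_apply_ne _ _ _ (Ne.symm h), lp.single_zero]; rfl
    simp only [h0, Finset.sum_ite_eq']
  refine ⟨Q * K, hQ.comp_clm K, ?_⟩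
  rw [dist_eq_norm]
  refine (norm_le_of_block_le _ (fun v => 2 * |R| * ‖H‖ / ρ * ind v) (hsum.mul_left _)
    fun x y => ?_).trans_lt ?_
  · have h1 : siteProj M x ∘L (K - Q * K) ∘L siteProj M y =
        (siteProj M x - siteProj M x * Q) * (K * siteProj M y) := by
      show siteProj M x * ((K - Q * K) * siteProj M y) = _
      noncomm_ring
    have hnn : 0 ≤ 2 * |R| * ‖H‖ / ρ * ind (x - y) := mul_nonneg (by positivity) (hind0 _)
    rw [h1, hQx]
    by_cases hx : x ∈ F
    · simpa [hx] using hnn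
    · rw [if_neg hx, sub_zero]
      change ‖siteProj M x ∘L K ∘L siteProj M y‖ ≤ _
      rw [block_commutator]
      by_cases hxy : ‖x.toEuclid - y.toEuclid‖ ≤ R
      · have h2 : ind (x - y) = 1 := if_pos (by rwa [toEuclid_sub])
        have h3 : ρ < ‖x.toEuclid - a‖ := not_le.mp fun h => hx ((hF x).mpr h)
        have hR0 : 0 ≤ R := (norm_nonneg _).trans hxy
        rw [h2, norm_smul, Complex.norm_real, Real.norm_eq_abs, mul_one, abs_of_nonneg hR0]
        calc _ ≤ (2 * ‖x.toEuclid - y.toEuclid‖ / ‖x.toEuclid - a‖) * ‖H‖ := by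
              gcongr
              · exact abs_direction_sub_le a j x y (hρ0.trans h3)
              · exact norm_block_le H x y
          _ ≤ 2 * R / ρ * ‖H‖ := by gcongr
          _ = _ := by ring
      · rw [hH x y (not_le.mp hxy)]
        simpa using hnn
  · rw [tsum_mul_left, ← hN, div_mul_eq_mul_div, div_lt_iff₀ hρ0, hρ]
    rw [mul_add, mul_div_cancel₀ _ hε.ne']
    linarith

theorem unitPosition_isSelfAdjoint {d M : ℕ} (a : EuclideanSpace ℝ (Fin d)) (j : Fin d) :
    IsSelfAdjoint (unitPosition M a j) := by
  rw [ContinuousLinearMap.isSelfAdjoint_iff_isSymmetric]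
  intro φ ψ
  rw [ContinuousLinearMap.coe_coe, lp.inner_eq_tsum, lp.inner_eq_tsum]
  simp only [unitPosition_apply, inner_smul_left, inner_smul_right, Complex.conj_ofReal]

/-- Continuous functions of `H` have a compact commutator with `u` as soon as `H` has. -/
theorem isCompactOperator_commutator_cfc {V : Type*} [NormedAddCommGroup V]
    [InnerProductSpace ℂ V] [CompleteSpace V] {H u : V →L[ℂ] V} (hH : IsSelfAdjoint H)
    (h : IsCompactOperator (u * H - H * u)) (f : ℝ → ℝ) :
    IsCompactOperator (u * cfc f H - cfc f H * u) := by
  let C := compactOperator (RingHom.id ℂ) V V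
  have hl : ∀ S T : V →L[ℂ] V, T ∈ C → S * T ∈ C := fun S T hT => 
    IsCompactOperator.clm_comp (f := T) hT S
  have hr : ∀ S T : V →L[ℂ] V, T ∈ C → T * S ∈ C := fun S T hT =>
    IsCompactOperator.comp_clm (f := T) hT S
  -- The operators that, together with their adjoints, have compact commutator with `u` form a
  -- closed star subalgebra by the Leibniz rule. It contains `H`, hence every `cfc f H`; continuity
  -- of `f` is not needed because `cfc` is 0 otherwise.
  let A : StarSubalgebra ℝ (V →L[ℂ] V) :=
    { carrier := {T | u * T - T * u ∈ C ∧ u * star T - star T * u ∈ C}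
      mul_mem' := by
        have key : ∀ S T : V →L[ℂ] V, u * S - S * u ∈ C → u * T - T * u ∈ C →
            u * (S * T) - (S * T) * u ∈ C := by
          intro S T hS hT
          have : u * (S * T) - (S * T) * u = (u * S - S * u) * T + S * (u * T - T * u) := by
            noncomm_ring
          rw [this]
          exact add_mem (hr _ _ hS) (hl _ _ hT)
        intro S T hS hT
        refine ⟨key S T hS.1 hT.1, ?_⟩
        rw [star_mul]
        exact key _ _ hT.2 hS.2
      add_mem' := by
        intro S T hS hT
        refine ⟨?_, ?_⟩
        · have : u * (S + T) - (S + T) * u = (u * S - S * u) + (u * T - T * u) := by noncomm_ring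
          rw [this]; exact add_mem hS.1 hT.1
        · have : u * star (S + T) - star (S + T) * u =
            (u * star S - star S * u) + (u * star T - star T * u) := by
              rw [star_add]; noncomm_ring
          rw [this]; exact add_mem hS.2 hT.2
      algebraMap_mem' := by
        intro r
        have h1 : ∀ r : ℝ, u * algebraMap ℝ (V →L[ℂ] V) r - algebraMap ℝ (V →L[ℂ] V) r * u = 0 :=
          fun r => by rw [Algebra.commutes, sub_self]
        refine ⟨?_, ?_⟩
        · rw [h1]; exact zero_mem _
        · rw [← algebraMap_star_comm, h1]; exact zero_mem _
      star_mem' := by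
        intro T hT
        exact ⟨hT.2, by rw [star_star]; exact hT.1⟩ }
  have hCc : IsClosed (C : Set (V →L[ℂ] V)) := isClosed_setOfPred_isCompactOperator
  have : IsClosed (A : Set (V →L[ℂ] V)) := by
    refine IsClosed.inter (s₁ := {T | u * T - T * u ∈ C})
      (s₂ := {T | u * star T - star T * u ∈ C}) ?_ ?_
    · exact hCc.preimage (by fun_prop)
    · exact hCc.preimage (by fun_prop)
  have hmem : H ∈ A := ⟨h, by rw [hH.star_eq]; exact h⟩
  exact (cfc_mem (s := A) f hmem).1

/-! ## The spectral projection at a gap -/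

section Gap

variable {V : Type*} [NormedAddCommGroup V] [InnerProductSpace ℂ V]

/-- The indicator function of `(-∞, E)`. -/
def stepBelow (E r : ℝ) : ℝ := if r < E then 1 else 0

theorem continuousOn_stepBelow (E : ℝ) : ContinuousOn (stepBelow E) {E}ᶜ := by
  intro r hr
  refine ContinuousAt.continuousWithinAt ?_
  rcases lt_or_gt_of_ne (show r ≠ E from hr) with h | h
  · refine (continuousAt_const (y := (1 : ℝ))).congr ?_
    filter_upwards [gt_mem_nhds h] with s hs using (if_pos hs).symm
  · refine (continuousAt_const (y := (0 : ℝ))).congr ?_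
    filter_upwards [lt_mem_nhds h] with s hs using (if_neg (not_lt.mpr (le_of_lt hs))).symm

theorem spectrum_real_subset_compl {H : V →L[ℂ] V} {E : ℝ} (hE : (E : ℂ) ∉ spectrum ℂ H) :
    spectrum ℝ H ⊆ {E}ᶜ := by
  rintro r hr rfl
  exact hE ((spectrum.algebraMap_mem_iff ℂ).mpr hr)

variable [CompleteSpace V]

theorem isStarProjection_projBelow (H : V →L[ℂ] V) (E : ℝ) : IsStarProjection (projBelow H E) :=
  isStarProjection_starProjection

/-- The spectral projection and the positive part of `E - H` have the same range: each factors
through the other, and the range of a projection is already closed. The gap is what makes the step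
function continuous on the spectrum. -/
theorem projBelow_eq_cfc {H : V →L[ℂ] V} (hH : IsSelfAdjoint H) {E : ℝ}
    (hE : (E : ℂ) ∉ spectrum ℂ H) : projBelow H E = cfc (stepBelow E) H := by
  have hs := spectrum_real_subset_compl hE
  have hstep := (continuousOn_stepBelow E).mono hs
  have hpart : ContinuousOn (fun r : ℝ => max (E - r) 0) (spectrum ℝ H) := by fun_prop
  -- The inverse of the positive part on the states below `E`; the denominator does not vanish on
  -- the spectrum.
  have hinv : ContinuousOn (fun r : ℝ => stepBelow E r / (E - r)) (spectrum ℝ H) :=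
    hstep.div (by fun_prop) fun r hr => sub_ne_zero.mpr (Ne.symm (hs hr))
  set P := cfc (stepBelow E) H with hP
  set F := cfc (fun r : ℝ => max (E - r) 0) H with hF
  have hPF : F = P * F := by
    rw [hP, hF, ← cfc_mul _ _ H hstep hpart]
    refine cfc_congr fun r _ => ?_
    by_cases h : r < E
    · simp [stepBelow, h]
    · simp [stepBelow, h, not_lt.mp h]
  have hFP : P = F * cfc (fun r : ℝ => stepBelow E r / (E - r)) H := by
    rw [hP, hF, ← cfc_mul _ _ H hpart hinv]
    refine cfc_congr fun r _ => ?_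
    by_cases h : r < E
    · have h1 : E - r ≠ 0 := (sub_pos.mpr h).ne'
      simp [stepBelow, h, max_eq_left (sub_pos.mpr h).le, h1]
    · simp [stepBelow, h]
  have hproj : IsStarProjection P := by
    refine ⟨?_, cfc_predicate _ _⟩
    rw [IsIdempotentElem, hP, ← cfc_mul _ _ H hstep hstep]
    refine cfc_congr fun r _ => ?_
    simp [stepBelow]
  obtain ⟨hp, hPr⟩ := isStarProjection_iff_eq_starProjection_range.mp hproj
  have hr : (F.range).topologicalClosure = P.range := by
    have h1 : F.range = P.range := by
      apply le_antisymm
      · rw [hPF]; rintro _ ⟨v, rfl⟩; exact ⟨F v, rfl⟩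
      · rw [hFP]; rintro _ ⟨v, rfl⟩; exact ⟨_, rfl⟩
    rw [h1]
    exact (ContinuousLinearMap.IsIdempotentElem.isClosed_range hproj.1).submodule_topologicalClosure_eq
  rw [projBelow, hPr]
  congr 1

/-! ### Stability of the gap and norm continuity of the spectral projection. -/

theorem isOpen_setOf_notMem_spectrum (z : ℂ) : IsOpen {H : V →L[ℂ] V | z ∉ spectrum ℂ H} := by
  have h : {H : V →L[ℂ] V | z ∉ spectrum ℂ H} =
      (fun H => algebraMap ℂ (V →L[ℂ] V) z - H) ⁻¹' {u | IsUnit u} := by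
    ext H
    exact not_not
  rw [h]
  exact Units.isOpen.preimage (by fun_prop)

/-- The step function is continuous on the open set `{E}ᶜ`, which is a neighbourhood of every
spectrum in question, so the functional calculus is norm continuous in the operator. -/
theorem continuousOn_projBelow (E : ℝ) :
    ContinuousOn (fun H : V →L[ℂ] V => projBelow H E)
      {H | IsSelfAdjoint H ∧ (E : ℂ) ∉ spectrum ℂ H} := by
  have h : ContinuousOn (fun H : V →L[ℂ] V => cfc (stepBelow E) H)
      {H | IsSelfAdjoint H ∧ (E : ℂ) ∉ spectrum ℂ H} := by
    refine ContinuousOn.cfc_of_mem_nhdsSet (s := {E}ᶜ) (stepBelow E) ?_ continuousOn_id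
      (fun H hH => hH.1) (continuousOn_stepBelow E)
    rw [isOpen_compl_singleton.mem_nhdsSet]
    exact Set.iUnion₂_subset fun H hH => spectrum_real_subset_compl hH.2
  exact h.congr fun H hH => projBelow_eq_cfc hH.1 hH.2

/-! ## Antilinear symmetries and the functional calculus -/

/-- Pairs `(T, T')` with `Θ T = T' Θ`, also for the adjoints, form a closed star subalgebra of the
product, and the functional calculus acts there componentwise. The scalars are real because `Θ` is
antilinear. Two operators are allowed so that `H' = -H` covers particle-hole symmetry. -/
theorem cfc_antilinear_comm {Θ : V →SL[starRingEnd ℂ] V} {H H' : V →L[ℂ] V}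
    (hH : IsSelfAdjoint H) (hH' : IsSelfAdjoint H') (h : ∀ φ, Θ (H φ) = H' (Θ φ)) {f : ℝ → ℝ}
    (hf : ContinuousOn f (spectrum ℝ H ∪ spectrum ℝ H')) (φ : V) :
    Θ (cfc f H φ) = cfc f H' (Θ φ) := by
  let A : StarSubalgebra ℝ ((V →L[ℂ] V) × (V →L[ℂ] V)) :=
    { carrier := {p | (∀ φ, Θ (p.1 φ) = p.2 (Θ φ)) ∧ ∀ φ, Θ ((star p).1 φ) = (star p).2 (Θ φ)}
      mul_mem' := by
        intro p q hp hq
        refine ⟨fun φ => ?_, fun φ => ?_⟩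
        · show Θ (p.1 (q.1 φ)) = p.2 (q.2 (Θ φ))
          rw [hp.1, hq.1]
        · rw [star_mul]
          show Θ ((star q).1 ((star p).1 φ)) = (star q).2 ((star p).2 (Θ φ))
          rw [hq.2, hp.2]
      add_mem' := by
        intro p q hp hq
        refine ⟨fun φ => ?_, fun φ => ?_⟩
        · show Θ (p.1 φ + q.1 φ) = p.2 (Θ φ) + q.2 (Θ φ)
          rw [map_add, hp.1, hq.1]
        · rw [star_add]
          show Θ ((star p).1 φ + (star q).1 φ) = (star p).2 (Θ φ) + (star q).2 (Θ φ)
          rw [map_add, hp.2, hq.2]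
      algebraMap_mem' := by
        intro r
        have key : ∀ φ, Θ ((algebraMap ℝ ((V →L[ℂ] V) × (V →L[ℂ] V)) r).1 φ) =
            (algebraMap ℝ ((V →L[ℂ] V) × (V →L[ℂ] V)) r).2 (Θ φ) := by
          intro φ
          show Θ ((r : ℂ) • φ) = (r : ℂ) • Θ φ
          rw [map_smulₛₗ, Complex.conj_ofReal]
        refine ⟨key, ?_⟩
        rw [← algebraMap_star_comm]
        exact key
      star_mem' := by
        intro p hp
        exact ⟨hp.2, by rw [star_star]; exact hp.1⟩ }
  have hev : ∀ φ : V, Continuous fun T : V →L[ℂ] V => T φ := fun φ =>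
    (ContinuousLinearMap.apply ℂ V φ).continuous
  have : IsClosed (A : Set ((V →L[ℂ] V) × (V →L[ℂ] V))) := by
    have h1 : ∀ φ, IsClosed {p : (V →L[ℂ] V) × (V →L[ℂ] V) | Θ (p.1 φ) = p.2 (Θ φ)} := fun φ =>
      isClosed_eq (Θ.continuous.comp ((hev φ).comp continuous_fst))
        ((hev (Θ φ)).comp continuous_snd)
    have h2 : (A : Set ((V →L[ℂ] V) × (V →L[ℂ] V))) =
        (⋂ φ, {p | Θ (p.1 φ) = p.2 (Θ φ)}) ∩
          star ⁻¹' (⋂ φ, {p | Θ (p.1 φ) = p.2 (Θ φ)}) := by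
      ext p
      simp only [Set.mem_inter_iff, Set.mem_preimage, Set.mem_iInter]
      rfl
    rw [h2]
    exact (isClosed_iInter h1).inter ((isClosed_iInter h1).preimage continuous_star)
  have hsa : IsSelfAdjoint (H, H') := Prod.ext hH hH'
  have hmem : (H, H') ∈ A := ⟨h, by rw [hsa.star_eq]; exact h⟩
  have : ContinuousFunctionalCalculus ℝ ((V →L[ℂ] V) × (V →L[ℂ] V)) IsSelfAdjoint :=
    IsSelfAdjoint.instContinuousFunctionalCalculus (A := (V →L[ℂ] V) × (V →L[ℂ] V))
  have h3 := (cfc_mem (s := A) f hmem).1 φ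
  rw [cfc_map_prod (S := ℝ) f H H' hf hsa hH hH'] at h3
  exact h3

theorem projBelow_antilinear_comm {Θ : V →SL[starRingEnd ℂ] V} {H : V →L[ℂ] V}
    (hH : IsSelfAdjoint H) {E : ℝ} (hE : (E : ℂ) ∉ spectrum ℂ H)
    (h : ∀ φ, Θ (H φ) = H (Θ φ)) (φ : V) : Θ (projBelow H E φ) = projBelow H E (Θ φ) := by
  rw [projBelow_eq_cfc hH hE]
  refine cfc_antilinear_comm hH hH h ((continuousOn_stepBelow E).mono ?_) φ
  rw [Set.union_self]
  exact spectrum_real_subset_compl hE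

theorem projBelow_antilinear_anticomm {Θ : V →SL[starRingEnd ℂ] V} {H : V →L[ℂ] V}
    (hH : IsSelfAdjoint H) (h0 : ((0 : ℝ) : ℂ) ∉ spectrum ℂ H)
    (h : ∀ φ, Θ (H φ) = -H (Θ φ)) (φ : V) :
    Θ (projBelow H 0 φ) = (1 - projBelow H 0) (Θ φ) := by
  have hs := spectrum_real_subset_compl h0
  have hs' : spectrum ℝ (-H) ⊆ {0}ᶜ := by
    rw [← spectrum.neg_eq]
    intro r hr hr0
    exact hs hr (by simpa using hr0)
  rw [projBelow_eq_cfc hH h0]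
  -- Reflecting the energy exchanges the states below and above 0; the value of the step function at
  -- 0 does not matter because 0 is not in the spectrum.
  have hneg : cfc (stepBelow 0) (-H) = 1 - cfc (stepBelow 0) H := by
    rw [← cfc_comp_neg (stepBelow 0) H ((continuousOn_stepBelow 0).mono (by
      rintro _ ⟨r, hr, rfl⟩ hr0
      exact hs hr (by simpa using hr0))), ← cfc_one ℝ H,
      ← cfc_sub 1 _ H continuousOn_const ((continuousOn_stepBelow 0).mono hs)]
    refine cfc_congr fun r hr => ?_
    have hr0 : r ≠ 0 := hs hr
    rcases lt_or_gt_of_ne hr0 with h | h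
    · simp [stepBelow, h, h.le]
    · simp [stepBelow, h, not_lt.mpr h.le]
  rw [← hneg]
  exact cfc_antilinear_comm hH hH.neg h
    ((continuousOn_stepBelow 0).mono (Set.union_subset hs hs')) φ

end Gap

/-- The transformation `φ ↦ U (conj φ)` as a bounded antilinear map. -/
def antiMap {M : ℕ} (d : ℕ) (u : Matrix (Fin M) (Fin M) ℂ) :
    WaveFn d M →SL[starRingEnd ℂ] WaveFn d M :=
  (onsite d u).comp
    (LinearMap.mkContinuous
      { toFun := conj
        map_add' := fun φ ψ => by
          ext x α
          exact map_add (starRingEnd ℂ) _ _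
        map_smul' := fun c φ => by
          ext x α
          exact map_mul (starRingEnd ℂ) _ _ } 1
      (fun φ => by
        have h2 : (0 : ℝ) < (2 : ℝ≥0∞).toReal := by norm_num
        refine lp.norm_le_of_forall_sum_le h2 (by positivity) fun s => ?_
        rw [one_mul]
        refine le_trans (le_of_eq ?_) (lp.sum_rpow_le_norm_rpow h2 φ s)
        refine Finset.sum_congr rfl fun x _ => ?_
        congr 1
        simp [conj, EuclideanSpace.norm_eq]) :
      WaveFn d M →SL[starRingEnd ℂ] WaveFn d M)

theorem antiMap_apply {d M : ℕ} (u : Matrix (Fin M) (Fin M) ℂ) (φ : WaveFn d M) :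
    antiMap d u φ = antiOp u φ := rfl

/-- The position direction is a real scalar at each site and `u` acts only on the internal space. -/
theorem antiMap_unitPosition {d M : ℕ} (u : Matrix (Fin M) (Fin M) ℂ)
    (a : EuclideanSpace ℝ (Fin d)) (j : Fin d) (φ : WaveFn d M) :
    antiMap d u (unitPosition M a j φ) = unitPosition M a j (antiMap d u φ) := by
  have h1 : conj (unitPosition M a j φ) = unitPosition M a j (conj φ) := by
    ext x α
    show starRingEnd ℂ ((direction a j x : ℂ) * φ x α) = (direction a j x : ℂ) * starRingEnd ℂ (φ x α)
    rw [map_mul, Complex.conj_ofReal]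
  rw [antiMap_apply, antiMap_apply, antiOp, antiOp, h1]
  ext x : 2
  show Matrix.toEuclideanCLM (𝕜 := ℂ) u ((direction a j x : ℂ) • conj φ x) =
    (direction a j x : ℂ) • Matrix.toEuclideanCLM (𝕜 := ℂ) u (conj φ x)
  exact map_smul _ _ _

/-! ## Kronecker products and gamma matrices -/

theorem kron_mul {n : ℕ} (m m' : Fin n → Matrix (Fin 2) (Fin 2) ℂ) :
    kron m * kron m' = kron fun k => m k * m' k := by
  ext s s'
  simp only [kron, Matrix.mul_apply, Matrix.of_apply, ← Finset.prod_mul_distrib]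
  rw [Finset.prod_univ_sum, Fintype.piFinset_univ]

theorem kron_one {n : ℕ} : kron (fun _ : Fin n => (1 : Matrix (Fin 2) (Fin 2) ℂ)) = 1 := by
  ext s s'
  simp only [kron, Matrix.of_apply, Matrix.one_apply]
  rw [Finset.prod_ite_zero]
  simp [funext_iff]

theorem kron_smul {n : ℕ} (c : Fin n → ℂ) (m : Fin n → Matrix (Fin 2) (Fin 2) ℂ) :
    kron (fun k => c k • m k) = (∏ k, c k) • kron m := by
  ext s s'
  simp [kron, Finset.prod_mul_distrib]

theorem kron_map_conj {n : ℕ} (m : Fin n → Matrix (Fin 2) (Fin 2) ℂ) :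
    (kron m).map (starRingEnd ℂ) = kron fun k => (m k).map (starRingEnd ℂ) := by
  ext s s'
  simp [kron, map_prod]

theorem kron_conjTranspose {n : ℕ} (m : Fin n → Matrix (Fin 2) (Fin 2) ℂ) :
    (kron m).conjTranspose = kron fun k => (m k).conjTranspose := by
  ext s s'
  simp [kron, Matrix.conjTranspose_apply]

/-- Each tensor slot contributes a sign, and exactly one of them is negative. -/
theorem kron_anticomm {n : ℕ} {m m' : Fin n → Matrix (Fin 2) (Fin 2) ℂ} (i : Fin n)
    (hi : m i * m' i = -(m' i * m i)) (h : ∀ k ≠ i, m k * m' k = m' k * m k) :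
    kron m * kron m' = -(kron m' * kron m) := by
  rw [kron_mul, kron_mul]
  have h1 : (fun k => m k * m' k) = fun k => (if k = i then (-1 : ℂ) else 1) • (m' k * m k) := by
    ext1 k
    by_cases hk : k = i
    · subst hk; simp [hi]
    · simp [hk, h k hk]
  rw [h1, kron_smul]
  simp

theorem pauli₁_sq : pauli₁ * pauli₁ = 1 := by
  ext i j; fin_cases i <;> fin_cases j <;> simp [pauli₁, Matrix.mul_apply]

theorem pauli₂_sq : pauli₂ * pauli₂ = 1 := by
  ext i j; fin_cases i <;> fin_cases j <;> simp [pauli₂, Matrix.mul_apply]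

theorem pauli₃_sq : pauli₃ * pauli₃ = 1 := by
  ext i j; fin_cases i <;> fin_cases j <;> simp [pauli₃, Matrix.mul_apply]

theorem pauli₁_mul_pauli₂ : pauli₁ * pauli₂ = -(pauli₂ * pauli₁) := by
  ext i j; fin_cases i <;> fin_cases j <;> simp [pauli₁, pauli₂, Matrix.mul_apply]

theorem pauli₁_mul_pauli₃ : pauli₁ * pauli₃ = -(pauli₃ * pauli₁) := by
  ext i j; fin_cases i <;> fin_cases j <;> simp [pauli₁, pauli₃, Matrix.mul_apply]

theorem pauli₂_mul_pauli₃ : pauli₂ * pauli₃ = -(pauli₃ * pauli₂) := by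
  ext i j; fin_cases i <;> fin_cases j <;> simp [pauli₂, pauli₃, Matrix.mul_apply]

theorem pauli₂_mul_pauli₁ : pauli₂ * pauli₁ = -(pauli₁ * pauli₂) := by
  rw [pauli₁_mul_pauli₂, neg_neg]

theorem pauli₃_mul_pauli₁ : pauli₃ * pauli₁ = -(pauli₁ * pauli₃) := by
  rw [pauli₁_mul_pauli₃, neg_neg]

theorem pauli₃_mul_pauli₂ : pauli₃ * pauli₂ = -(pauli₂ * pauli₃) := by
  rw [pauli₂_mul_pauli₃, neg_neg]

theorem pauli₁_conjTranspose : pauli₁.conjTranspose = pauli₁ := by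
  ext i j; fin_cases i <;> fin_cases j <;> simp [pauli₁, Matrix.conjTranspose_apply]

theorem pauli₂_conjTranspose : pauli₂.conjTranspose = pauli₂ := by
  ext i j; fin_cases i <;> fin_cases j <;> simp [pauli₂, Matrix.conjTranspose_apply]

theorem pauli₃_conjTranspose : pauli₃.conjTranspose = pauli₃ := by
  ext i j; fin_cases i <;> fin_cases j <;> simp [pauli₃, Matrix.conjTranspose_apply]

theorem pauli₁_map_conj : pauli₁.map (starRingEnd ℂ) = pauli₁ := by
  ext i j; fin_cases i <;> fin_cases j <;> simp [pauli₁]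

theorem pauli₂_map_conj : pauli₂.map (starRingEnd ℂ) = -pauli₂ := by
  ext i j; fin_cases i <;> fin_cases j <;> simp [pauli₂]

theorem pauli₃_map_conj : pauli₃.map (starRingEnd ℂ) = pauli₃ := by
  ext i j; fin_cases i <;> fin_cases j <;> simp [pauli₃]

theorem gammaMat_sq {n : ℕ} (j : Fin (2 * n)) : gammaMat n j * gammaMat n j = 1 := by
  rw [gammaMat, kron_mul, ← kron_one]
  congr 1
  ext1 k
  split_ifs <;> simp [pauli₁_sq, pauli₂_sq, pauli₃_sq]

theorem gammaLast_sq {n : ℕ} : gammaLast n * gammaLast n = 1 := by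
  rw [gammaLast, kron_mul, ← kron_one]
  simp [pauli₃_sq]

theorem gammaMat_conjTranspose {n : ℕ} (j : Fin (2 * n)) :
    (gammaMat n j).conjTranspose = gammaMat n j := by
  rw [gammaMat, kron_conjTranspose]
  congr 1
  ext1 k
  split_ifs <;> simp [pauli₁_conjTranspose, pauli₂_conjTranspose, pauli₃_conjTranspose]

theorem gammaLast_conjTranspose {n : ℕ} : (gammaLast n).conjTranspose = gammaLast n := by
  rw [gammaLast, kron_conjTranspose, pauli₃_conjTranspose]

/-- The decisive slot is `j / 2`, where `σ₃` meets `σ₁` or `σ₂`. Before it `γ^{(j)}` is the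
identity, after it both factors are `σ₃`. -/
theorem gammaMat_anticomm_of_div_lt {n : ℕ} {i j : Fin (2 * n)} (h : (i : ℕ) / 2 < (j : ℕ) / 2) :
    gammaMat n i * gammaMat n j = -(gammaMat n j * gammaMat n i) := by
  have hj : (j : ℕ) / 2 < n := by omega
  refine kron_anticomm ⟨(j : ℕ) / 2, hj⟩ ?_ ?_
  · have h1 : ¬ (j : ℕ) / 2 < (i : ℕ) / 2 := by omega
    have h2 : ¬ (j : ℕ) / 2 = (i : ℕ) / 2 := by omega
    simp only [h1, h2, if_false, lt_irrefl, if_true]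
    split_ifs
    · exact pauli₃_mul_pauli₁
    · exact pauli₃_mul_pauli₂
  · intro k hk
    have hk' : ¬ (k : ℕ) = (j : ℕ) / 2 := fun e => hk (Fin.ext e)
    rcases lt_or_ge (k : ℕ) ((j : ℕ) / 2) with h3 | h3
    · simp [h3]
    · have h1 : ¬ (k : ℕ) < (i : ℕ) / 2 := by omega
      have h2 : ¬ (k : ℕ) = (i : ℕ) / 2 := by omega
      simp [not_lt.mpr h3, hk', h1, h2]

theorem gammaMat_anticomm {n : ℕ} {i j : Fin (2 * n)} (h : i ≠ j) :
    gammaMat n i * gammaMat n j = -(gammaMat n j * gammaMat n i) := by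
  have hij : (i : ℕ) ≠ j := fun e => h (Fin.ext e)
  rcases lt_trichotomy ((i : ℕ) / 2) ((j : ℕ) / 2) with h1 | h1 | h1
  · exact gammaMat_anticomm_of_div_lt h1
  · have hj : (j : ℕ) / 2 < n := by omega
    refine kron_anticomm ⟨(j : ℕ) / 2, hj⟩ ?_ ?_
    · simp only [h1, if_false, lt_irrefl, if_true]
      rcases Nat.mod_two_eq_zero_or_one (i : ℕ) with hi | hi <;>
        rcases Nat.mod_two_eq_zero_or_one (j : ℕ) with hj | hj
      · omega
      · simp only [hi, hj, if_true, one_ne_zero, if_false]; exact pauli₁_mul_pauli₂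
      · simp only [hi, hj, if_true, one_ne_zero, if_false]; exact pauli₂_mul_pauli₁
      · omega
    · intro k hk
      have hk' : ¬ (k : ℕ) = (j : ℕ) / 2 := fun e => hk (Fin.ext e)
      simp only [h1, hk', if_false]
  · rw [gammaMat_anticomm_of_div_lt h1, neg_neg]

theorem gammaLast_anticomm {n : ℕ} (j : Fin (2 * n)) :
    gammaLast n * gammaMat n j = -(gammaMat n j * gammaLast n) := by
  have hj : (j : ℕ) / 2 < n := by omega
  refine kron_anticomm ⟨(j : ℕ) / 2, hj⟩ ?_ ?_
  · simp only [if_false, lt_irrefl, if_true]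
    split_ifs
    · exact pauli₃_mul_pauli₁
    · exact pauli₃_mul_pauli₂
  · intro k hk
    have hk' : ¬ (k : ℕ) = (j : ℕ) / 2 := fun e => hk (Fin.ext e)
    split_ifs <;> simp

/-- The matrix of an antiunitary operator on spinors which commutes or anticommutes with all gamma
matrices, according to the parity of `n`. -/
def spinConj (n : ℕ) : Matrix (Spin n) (Spin n) ℂ :=
  kron fun k => if (k : ℕ) % 2 = 0 then pauli₂ else pauli₁

/-- Here `p` is the slot carrying `σ₁` or `σ₂`. The alternating sign at that slot cancels the
dependence of the number of later slots on `p`, so that all gamma matrices get the same sign. -/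
theorem prod_fin_sign (n p : ℕ) (hp : p < n) :
    ∏ k : Fin n, (if (k : ℕ) < p then (1 : ℂ) else if (k : ℕ) = p then -(-1) ^ p else -1) =
      (-1) ^ n := by
  rw [Fin.prod_univ_eq_prod_range
    (fun k => if k < p then (1 : ℂ) else if k = p then -(-1) ^ p else -1)]
  induction n, hp using Nat.le_induction with
  | base =>
    rw [Finset.prod_range_succ, Finset.prod_eq_one fun k hk => if_pos (Finset.mem_range.mp hk)]
    simp [pow_succ]
  | succ n hn ih =>
    have h1 : ¬ n < p := by omega
    have h2 : ¬ n = p := by omega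
    rw [Finset.prod_range_succ, ih]
    simp [h1, h2, pow_succ]

/-- Only `σ₂` changes sign under conjugation, so at slot `p = j / 2` the matrices `σ₁` and `σ₂` get
the common sign `(-1)^(p+1)`. Each later slot gives `-1`, because both `σ₁` and `σ₂` anticommute
with `σ₃`. -/
theorem spinConj_mul_gammaMat {n : ℕ} (j : Fin (2 * n)) :
    spinConj n * (gammaMat n j).map (starRingEnd ℂ) =
      ((-1 : ℂ) ^ n • gammaMat n j) * spinConj n := by
  have hj : (j : ℕ) / 2 < n := by omega
  rw [Matrix.smul_mul, spinConj, gammaMat, kron_map_conj, kron_mul, kron_mul,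
    ← prod_fin_sign n _ hj, ← kron_smul]
  congr 1
  ext1 k
  rcases lt_trichotomy (k : ℕ) ((j : ℕ) / 2) with h | h | h
  · simp [h]
  · simp only [h, lt_irrefl, if_false, if_true]
    rcases Nat.mod_two_eq_zero_or_one ((j : ℕ) / 2) with hp | hp
    · rw [(Nat.even_iff.mpr hp).neg_one_pow]
      split_ifs <;> simp [pauli₁_map_conj, pauli₂_map_conj, pauli₂_mul_pauli₁]
    · rw [(Nat.odd_iff.mpr hp).neg_one_pow]
      have hp0 : ¬ (j : ℕ) / 2 % 2 = 0 := by omega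
      split_ifs <;> simp [pauli₁_map_conj, pauli₂_map_conj, pauli₁_mul_pauli₂]
  · simp only [not_lt.mpr h.le, h.ne', if_false, pauli₃_map_conj]
    split_ifs <;> simp [pauli₂_mul_pauli₃, pauli₁_mul_pauli₃]

theorem spinConj_mul_gammaLast {n : ℕ} :
    spinConj n * (gammaLast n).map (starRingEnd ℂ) =
      ((-1 : ℂ) ^ n • gammaLast n) * spinConj n := by
  have h1 : (-1 : ℂ) ^ n = ∏ _k : Fin n, (-1 : ℂ) := by simp
  rw [Matrix.smul_mul, spinConj, gammaLast, kron_map_conj, kron_mul, kron_mul, h1, ← kron_smul]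
  congr 1
  ext1 k
  rw [pauli₃_map_conj]
  split_ifs <;> simp [pauli₂_mul_pauli₃, pauli₁_mul_pauli₃]

/-- Each slot with `σ₂` gives `σ₂ conj(σ₂) = -1` and each slot with `σ₁` gives 1; there are `(n + 1)
/ 2` even numbers below `n`. -/
theorem spinConj_mul_conj {n : ℕ} :
    spinConj n * (spinConj n).map (starRingEnd ℂ) = ((-1 : ℂ) ^ ((n + 1) / 2)) • 1 := by
  have h1 : (-1 : ℂ) ^ ((n + 1) / 2) = ∏ k : Fin n, if (k : ℕ) % 2 = 0 then (-1 : ℂ) else 1 := by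
    rw [Fin.prod_univ_eq_prod_range (fun k => if k % 2 = 0 then (-1 : ℂ) else 1)]
    induction n with
    | zero => simp
    | succ n ih =>
      rw [Finset.prod_range_succ, ← ih]
      rcases Nat.mod_two_eq_zero_or_one n with h | h
      · have e : (n + 1 + 1) / 2 = (n + 1) / 2 + 1 := by omega
        rw [e, pow_succ, if_pos h]
      · have e : (n + 1 + 1) / 2 = (n + 1) / 2 := by omega
        rw [e, if_neg (by omega), mul_one]
  rw [spinConj, kron_map_conj, kron_mul, h1, ← kron_one, ← kron_smul]
  congr 1
  ext1 k
  split_ifs <;> simp [pauli₁_map_conj, pauli₂_map_conj, pauli₁_sq, pauli₂_sq]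

/-! ## Operators on spinor-valued wavefunctions -/

theorem tensorOp_apply {n M : ℕ} (T : WaveFn (2 * n) M →L[ℂ] WaveFn (2 * n) M)
    (g : Matrix (Spin n) (Spin n) ℂ) (φ : SpinWaveFn n M) (s : Spin n) :
    tensorOp T g φ s = ∑ s', g s s' • T (φ s') := by
  simp [tensorOp]

theorem spinWaveFn_ext {n M : ℕ} {S T : SpinWaveFn n M →L[ℂ] SpinWaveFn n M}
    (h : ∀ φ s, S φ s = T φ s) : S = T :=
  ContinuousLinearMap.ext fun φ => PiLp.ext fun s => h φ s

theorem tensorOp_mul {n M : ℕ} (S T : WaveFn (2 * n) M →L[ℂ] WaveFn (2 * n) M)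
    (g h : Matrix (Spin n) (Spin n) ℂ) :
    tensorOp S g * tensorOp T h = tensorOp (S * T) (g * h) := by
  refine spinWaveFn_ext fun φ s => ?_
  show tensorOp S g (tensorOp T h φ) s = _
  simp only [tensorOp_apply, map_sum, map_smul, Matrix.mul_apply, Finset.smul_sum, Finset.sum_smul,
    smul_smul]
  rw [Finset.sum_comm]
  rfl

theorem tensorOp_one {n M : ℕ} :
    tensorOp (1 : WaveFn (2 * n) M →L[ℂ] WaveFn (2 * n) M) 1 = 1 := by
  refine spinWaveFn_ext fun φ s => ?_
  simp [tensorOp_apply, Matrix.one_apply]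

theorem tensorOp_add_left {n M : ℕ} (S T : WaveFn (2 * n) M →L[ℂ] WaveFn (2 * n) M)
    (g : Matrix (Spin n) (Spin n) ℂ) : tensorOp (S + T) g = tensorOp S g + tensorOp T g := by
  refine spinWaveFn_ext fun φ s => ?_
  show _ = tensorOp S g φ s + tensorOp T g φ s
  simp only [tensorOp_apply, ← Finset.sum_add_distrib, ← smul_add]
  rfl

theorem tensorOp_smul_left {n M : ℕ} (c : ℂ) (T : WaveFn (2 * n) M →L[ℂ] WaveFn (2 * n) M)
    (g : Matrix (Spin n) (Spin n) ℂ) : tensorOp (c • T) g = c • tensorOp T g := by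
  refine spinWaveFn_ext fun φ s => ?_
  show _ = c • tensorOp T g φ s
  simp only [tensorOp_apply, Finset.smul_sum, smul_comm c]
  rfl

theorem tensorOp_smul_right {n M : ℕ} (c : ℂ) (T : WaveFn (2 * n) M →L[ℂ] WaveFn (2 * n) M)
    (g : Matrix (Spin n) (Spin n) ℂ) : tensorOp T (c • g) = c • tensorOp T g := by
  refine spinWaveFn_ext fun φ s => ?_
  show _ = c • tensorOp T g φ s
  simp only [tensorOp_apply, Finset.smul_sum, Matrix.smul_apply, smul_smul, smul_eq_mul]

/-- `T ↦ T ⊗ g` as a linear map. -/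
def tensorHom {n M : ℕ} (g : Matrix (Spin n) (Spin n) ℂ) :
    (WaveFn (2 * n) M →L[ℂ] WaveFn (2 * n) M) →ₗ[ℂ] (SpinWaveFn n M →L[ℂ] SpinWaveFn n M) where
  toFun T := tensorOp T g
  map_add' S T := tensorOp_add_left S T g
  map_smul' c T := tensorOp_smul_left c T g

theorem tensorOp_sub_left {n M : ℕ} (S T : WaveFn (2 * n) M →L[ℂ] WaveFn (2 * n) M)
    (g : Matrix (Spin n) (Spin n) ℂ) : tensorOp (S - T) g = tensorOp S g - tensorOp T g :=
  map_sub (tensorHom g) S T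

theorem tensorOp_star {n M : ℕ} (T : WaveFn (2 * n) M →L[ℂ] WaveFn (2 * n) M)
    (g : Matrix (Spin n) (Spin n) ℂ) : star (tensorOp T g) = tensorOp (star T) g.conjTranspose := by
  symm
  refine (ContinuousLinearMap.eq_adjoint_iff _ (tensorOp T g)).mpr ?_
  intro φ ψ
  rw [PiLp.inner_apply, PiLp.inner_apply]
  simp only [tensorOp_apply, sum_inner, inner_sum, inner_smul_left, inner_smul_right,
    ContinuousLinearMap.star_eq_adjoint, ContinuousLinearMap.adjoint_inner_left,
    Matrix.conjTranspose_apply]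
  rw [Finset.sum_comm]
  simp

/-- The operator `T ⊗ g` as a sum of its blocks. -/
theorem tensorOp_eq_sum {n M : ℕ} (T : WaveFn (2 * n) M →L[ℂ] WaveFn (2 * n) M)
    (g : Matrix (Spin n) (Spin n) ℂ) :
    tensorOp T g = ∑ s, ∑ s', g s s' •
      ((PiLp.continuousLinearEquiv 2 ℂ (fun _ : Spin n => WaveFn (2 * n) M)).symm.toContinuousLinearMap
        ∘L ContinuousLinearMap.single ℂ (fun _ : Spin n => WaveFn (2 * n) M) s) ∘L T ∘L
      PiLp.proj 2 (fun _ : Spin n => WaveFn (2 * n) M) s' := by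
  refine spinWaveFn_ext fun φ s => ?_
  rw [tensorOp_apply]
  simp only [sum_apply]
  simp [Pi.single_apply, Finset.sum_apply]

theorem continuous_tensorOp {n M : ℕ} (g : Matrix (Spin n) (Spin n) ℂ) :
    Continuous fun T : WaveFn (2 * n) M →L[ℂ] WaveFn (2 * n) M => tensorOp T g := by
  simp only [tensorOp_eq_sum]
  fun_prop

theorem isCompactOperator_sandwich {V W : Type*} [NormedAddCommGroup V] [NormedSpace ℂ V]
    [NormedAddCommGroup W] [NormedSpace ℂ W] {T : V →L[ℂ] V} (hT : IsCompactOperator T)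
    (S : V →L[ℂ] W) (R : W →L[ℂ] V) : IsCompactOperator (S ∘L T ∘L R) :=
  (hT.comp_clm R).clm_comp S

theorem isSelfAdjoint_sum_clm {V ι : Type*} [NormedAddCommGroup V] [InnerProductSpace ℂ V]
    [CompleteSpace V] (s : Finset ι) {T : ι → V →L[ℂ] V} (h : ∀ i, IsSelfAdjoint (T i)) :
    IsSelfAdjoint (∑ i ∈ s, T i) :=
  isSelfAdjoint_sum s fun i _ => h i

theorem isCompactOperator_tensorOp {n M : ℕ} {T : WaveFn (2 * n) M →L[ℂ] WaveFn (2 * n) M}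
    (hT : IsCompactOperator T) (g : Matrix (Spin n) (Spin n) ℂ) :
    IsCompactOperator (tensorOp T g) := by
  rw [tensorOp_eq_sum]
  refine sum_mem (S := compactOperator (RingHom.id ℂ) (SpinWaveFn n M) (SpinWaveFn n M))
    fun s _ => sum_mem fun s' _ => Submodule.smul_mem _ _ ?_
  exact isCompactOperator_sandwich hT _ _

theorem grading_sq {n M : ℕ} : grading n M * grading n M = 1 := by
  rw [grading, tensorOp_mul, gammaLast_sq, one_mul, tensorOp_one]

theorem grading_isSelfAdjoint {n M : ℕ} : IsSelfAdjoint (grading n M) := by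
  rw [IsSelfAdjoint, grading, tensorOp_star, gammaLast_conjTranspose, star_one]

theorem grading_mul_tensorOp_one {n M : ℕ} (T : WaveFn (2 * n) M →L[ℂ] WaveFn (2 * n) M) :
    grading n M * tensorOp T 1 = tensorOp T 1 * grading n M := by
  rw [grading, tensorOp_mul, tensorOp_mul, one_mul, one_mul, mul_one, mul_one]

theorem neg_one_smul_clm {V : Type*} [NormedAddCommGroup V] [NormedSpace ℂ V] (T : V →L[ℂ] V) :
    (-1 : ℂ) • T = -T := neg_one_smul ℂ T

theorem clm_eq_of_add_self {V : Type*} [NormedAddCommGroup V] [NormedSpace ℂ V] {S T : V →L[ℂ] V}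
    (h : S + S = T + T) : S = T := by
  rw [← two_smul ℂ S, ← two_smul ℂ T] at h
  exact smul_right_injective _ (two_ne_zero' ℂ) h

theorem tensorOp_neg_right {n M : ℕ} (T : WaveFn (2 * n) M →L[ℂ] WaveFn (2 * n) M)
    (g : Matrix (Spin n) (Spin n) ℂ) : tensorOp T (-g) = -tensorOp T g := by
  rw [← neg_one_smul ℂ g, tensorOp_smul_right]
  exact neg_one_smul_clm _

theorem grading_mul_dirac {n M : ℕ} (a : EuclideanSpace ℝ (Fin (2 * n))) :
    grading n M * dirac n M a = -(dirac n M a * grading n M) := by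
  rw [grading, dirac, Finset.mul_sum, Finset.sum_mul, ← Finset.sum_neg_distrib]
  refine Finset.sum_congr rfl fun j _ => ?_
  rw [tensorOp_mul, tensorOp_mul, gammaLast_anticomm, tensorOp_neg_right, one_mul, mul_one]

theorem dirac_isSelfAdjoint {n M : ℕ} (a : EuclideanSpace ℝ (Fin (2 * n))) :
    IsSelfAdjoint (dirac n M a) := by
  refine isSelfAdjoint_sum_clm _ fun j => ?_
  rw [IsSelfAdjoint, tensorOp_star, gammaMat_conjTranspose, (unitPosition_isSelfAdjoint a j).star_eq]

theorem unitPosition_comm {d M : ℕ} (a : EuclideanSpace ℝ (Fin d)) (i j : Fin d) :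
    unitPosition M a i * unitPosition M a j = unitPosition M a j * unitPosition M a i := by
  ext φ : 1
  show unitPosition M a i (unitPosition M a j φ) = unitPosition M a j (unitPosition M a i φ)
  ext x : 2
  simp only [unitPosition_apply]
  exact smul_comm _ _ _

theorem sum_unitPosition_sq {d M : ℕ} {a : EuclideanSpace ℝ (Fin d)}
    (ha : ∀ x : Site d, a ≠ x.toEuclid) :
    ∑ j, unitPosition M a j * unitPosition M a j = 1 := by
  ext φ x : 3
  have h1 : ((∑ j, unitPosition M a j * unitPosition M a j) φ) x =
      ∑ j, (direction a j x : ℂ) • (direction a j x : ℂ) • φ x := by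
    rw [sum_apply, lp.coeFn_sum, Finset.sum_apply]
    rfl
  -- At a lattice point equal to `a` all directions would be 0, so `a` must lie off the lattice.
  have hx : ‖x.toEuclid - a‖ ^ 2 ≠ 0 :=
    pow_ne_zero 2 (norm_ne_zero_iff.mpr (sub_ne_zero.mpr (ha x).symm))
  have h2 : ∑ j, direction a j x * direction a j x = 1 := by
    have h3 := EuclideanSpace.real_norm_sq_eq (x.toEuclid - a)
    simp only [direction, ← sq, div_pow, ← Finset.sum_div]
    rw [div_eq_one_iff_eq hx, h3]
    rfl
  rw [h1]
  simp only [smul_smul, ← Finset.sum_smul, ← Complex.ofReal_mul, ← Complex.ofReal_sum]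
  rw [h2, Complex.ofReal_one, one_smul]
  rfl

/-- The position directions commute, so the double sum may be written with the gamma matrices in
either order. Adding the two versions leaves only the diagonal of the anticommutators. -/
theorem dirac_sq {n M : ℕ} {a : EuclideanSpace ℝ (Fin (2 * n))}
    (ha : ∀ x : Site (2 * n), a ≠ x.toEuclid) : dirac n M a * dirac n M a = 1 := by
  have h1 : dirac n M a * dirac n M a = ∑ i, ∑ j,
      tensorOp (unitPosition M a i * unitPosition M a j) (gammaMat n i * gammaMat n j) := by
    simp only [dirac, Finset.sum_mul, Finset.mul_sum, tensorOp_mul]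
    rw [Finset.sum_comm]
  have h2 : dirac n M a * dirac n M a = ∑ i, ∑ j,
      tensorOp (unitPosition M a i * unitPosition M a j) (gammaMat n j * gammaMat n i) := by
    rw [h1, Finset.sum_comm]
    refine Finset.sum_congr rfl fun i _ => Finset.sum_congr rfl fun j _ => ?_
    rw [unitPosition_comm]
  have h3 : ∀ i j : Fin (2 * n),
      tensorOp (unitPosition M a i * unitPosition M a j) (gammaMat n i * gammaMat n j) +
      tensorOp (unitPosition M a i * unitPosition M a j) (gammaMat n j * gammaMat n i) =
      if i = j then tensorOp (unitPosition M a i * unitPosition M a i) 1 +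
        tensorOp (unitPosition M a i * unitPosition M a i) 1 else 0 := by
    intro i j
    split_ifs with h
    · subst h; rw [gammaMat_sq]
    · rw [gammaMat_anticomm h, tensorOp_neg_right, neg_add_cancel]
  have h5 : ∑ i, tensorOp (unitPosition M a i * unitPosition M a i)
      (1 : Matrix (Spin n) (Spin n) ℂ) = 1 := by
    have := map_sum (tensorHom (M := M) (1 : Matrix (Spin n) (Spin n) ℂ))
      (fun i => unitPosition M a i * unitPosition M a i) Finset.univ
    rw [sum_unitPosition_sq ha] at this
    exact this.symm.trans tensorOp_one
  apply clm_eq_of_add_self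
  nth_rewrite 1 [h1]
  rw [h2, ← Finset.sum_add_distrib]
  simp only [← Finset.sum_add_distrib, h3, Finset.sum_ite_eq, Finset.mem_univ, if_true]
  rw [Finset.sum_add_distrib, h5]

/-! ## Antilinear operators on spinor-valued wavefunctions -/

/-- The antilinear operator `Θ ⊗ g K`, with `K` the complex conjugation of spinors. -/
def antiTensor {n M : ℕ} (Θ : WaveFn (2 * n) M →SL[starRingEnd ℂ] WaveFn (2 * n) M)
    (g : Matrix (Spin n) (Spin n) ℂ) : SpinWaveFn n M →ₛₗ[starRingEnd ℂ] SpinWaveFn n M where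
  toFun φ := WithLp.toLp 2 fun s => ∑ s', g s s' • Θ (φ s')
  map_add' φ ψ := by
    ext s : 1
    simp [Finset.sum_add_distrib]
  map_smul' c φ := by
    ext s : 1
    simp [Finset.smul_sum, smul_comm _ (starRingEnd ℂ c)]

theorem antiTensor_apply {n M : ℕ} (Θ : WaveFn (2 * n) M →SL[starRingEnd ℂ] WaveFn (2 * n) M)
    (g : Matrix (Spin n) (Spin n) ℂ) (φ : SpinWaveFn n M) (s : Spin n) :
    antiTensor Θ g φ s = ∑ s', g s s' • Θ (φ s') := rfl

/-- Moving `Θ` past the entries of `g` conjugates them, which is why `C` has to intertwine the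
conjugate of `g` with `g'`. -/
theorem antiTensor_tensorOp {n M : ℕ} {Θ : WaveFn (2 * n) M →SL[starRingEnd ℂ] WaveFn (2 * n) M}
    {K K' : WaveFn (2 * n) M →L[ℂ] WaveFn (2 * n) M} (hK : ∀ φ, Θ (K φ) = K' (Θ φ))
    {C g g' : Matrix (Spin n) (Spin n) ℂ} (hg : C * g.map (starRingEnd ℂ) = g' * C)
    (φ : SpinWaveFn n M) :
    antiTensor Θ C (tensorOp K g φ) = tensorOp K' g' (antiTensor Θ C φ) := by
  refine PiLp.ext fun s => ?_
  simp only [antiTensor_apply, tensorOp_apply, map_sum, map_smulₛₗ, hK, Finset.smul_sum, smul_smul,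
    RingHom.id_apply]
  have h1 : ∀ s', ∑ t, C s t * starRingEnd ℂ (g t s') = ∑ t, g' s t * C t s' := by
    intro s'
    have := congrFun (congrFun hg s) s'
    simpa [Matrix.mul_apply] using this
  refine Finset.sum_comm.trans (Eq.trans ?_ Finset.sum_comm)
  refine Finset.sum_congr rfl fun s' _ => ?_
  rw [← Finset.sum_smul, ← Finset.sum_smul, h1]

theorem antiTensor_antiTensor {n M : ℕ}
    {Θ : WaveFn (2 * n) M →SL[starRingEnd ℂ] WaveFn (2 * n) M} {ε c : ℂ}
    (hΘ : ∀ φ, Θ (Θ φ) = ε • φ) {C : Matrix (Spin n) (Spin n) ℂ}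
    (hC : C * C.map (starRingEnd ℂ) = c • 1) (φ : SpinWaveFn n M) :
    antiTensor Θ C (antiTensor Θ C φ) = (c * ε) • φ := by
  refine PiLp.ext fun s => ?_
  simp only [antiTensor_apply, map_sum, map_smulₛₗ, hΘ, Finset.smul_sum, smul_smul]
  have h1 : ∀ s', ∑ t, C s t * starRingEnd ℂ (C t s') = c * if s = s' then 1 else 0 := by
    intro s'
    have := congrFun (congrFun hC s) s'
    simpa [Matrix.mul_apply, Matrix.one_apply] using this
  rw [Finset.sum_comm]
  have h2 : ∀ s', ∑ t, (C s t * (starRingEnd ℂ (C t s') * ε)) • φ s' =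
      ((c * if s = s' then 1 else 0) * ε) • φ s' := by
    intro s'
    rw [← h1, Finset.sum_mul, Finset.sum_smul]
    simp only [mul_assoc]
  refine (Finset.sum_congr rfl fun s' _ => h2 s').trans ?_
  simp

/-! ## Antilinear maps and dimensions -/

/-- Kramers degeneracy. -/
theorem even_finrank_of_antilinear {W : Type*} [AddCommGroup W] [Module ℂ W]
    [FiniteDimensional ℂ W] (X : W →ₛₗ[starRingEnd ℂ] W) {c : ℝ} (hc : 0 < c)
    (h : ∀ x, X (X x) = -((c : ℂ) • x)) : Even (Module.finrank ℂ W) := by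
  let b := Module.finBasis ℂ W
  let m : Matrix (Fin (Module.finrank ℂ W)) (Fin (Module.finrank ℂ W)) ℂ :=
    Matrix.of fun i j => b.repr (X (b j)) i
  -- In a basis `X` is `m` after complex conjugation, so its square is `m` times the conjugate of
  -- `m`. Taking determinants gives `|det m|² = (-c) ^ dim`, which is negative for odd dimension.
  have hm : m * m.map (starRingEnd ℂ) = (-(c : ℂ)) • 1 := by
    ext i k
    have h1 : X (∑ j, b.repr (X (b k)) j • b j) = -((c : ℂ) • b k) := by
      rw [b.sum_repr, h]
    have h2 := congrArg (fun x => b.repr x i) h1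
    simp only [map_sum, map_smulₛₗ, map_neg, RingHom.id_apply, Finsupp.coe_neg, Pi.neg_apply,
      Finsupp.smul_apply, Finsupp.finsetSum_apply, b.repr_self, smul_eq_mul] at h2
    simp only [m, Matrix.mul_apply, Matrix.of_apply, Matrix.map_apply, Matrix.smul_apply,
      Matrix.one_apply, smul_eq_mul]
    rw [Finset.sum_congr rfl fun j _ => mul_comm _ _, h2, Finsupp.single_apply]
    by_cases hik : k = i
    · simp [hik]
    · simp [hik, Ne.symm hik]
  have hdet := congrArg Matrix.det hm
  have hmap : (m.map (starRingEnd ℂ)).det = starRingEnd ℂ m.det :=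
    ((starRingEnd ℂ).map_det m).symm
  rw [Matrix.det_mul, hmap, Complex.mul_conj, Matrix.det_smul, Matrix.det_one, mul_one,
    Fintype.card_fin] at hdet
  have hreal : Complex.normSq m.det = (-c) ^ Module.finrank ℂ W := by exact_mod_cast hdet
  by_contra hodd
  have h1 : (-c) ^ Module.finrank ℂ W < 0 :=
    (Nat.not_even_iff_odd.mp hodd).pow_neg (neg_neg_of_pos hc)
  exact absurd (Complex.normSq_nonneg m.det) (not_le.mpr (hreal ▸ h1))

theorem even_finrank_submodule_of_antilinear {V : Type*} [AddCommGroup V] [Module ℂ V]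
    (X : V →ₛₗ[starRingEnd ℂ] V) (K : Submodule ℂ V) [FiniteDimensional ℂ K]
    (hK : ∀ x ∈ K, X x ∈ K) {c : ℝ} (hc : 0 < c) (h : ∀ x ∈ K, X (X x) = -((c : ℂ) • x)) :
    Even (Module.finrank ℂ K) := by
  let Y : K →ₛₗ[starRingEnd ℂ] K :=
    { toFun := fun x => ⟨X x, hK x x.2⟩
      map_add' := fun x y => Subtype.ext (map_add X (x : V) y)
      map_smul' := fun r x => Subtype.ext (map_smulₛₗ X r (x : V)) }
  exact even_finrank_of_antilinear Y hc fun x => Subtype.ext (h x x.2)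

theorem finrank_le_of_antilinear {V : Type*} [AddCommGroup V] [Module ℂ V]
    (X : V →ₛₗ[starRingEnd ℂ] V) (K L : Submodule ℂ V) [FiniteDimensional ℂ L]
    (h : ∀ x ∈ K, X x ∈ L) (h0 : ∀ x ∈ K, X x = 0 → x = 0) :
    Module.finrank ℂ K ≤ Module.finrank ℂ L := by
  -- An antilinear map is linear over `ℝ`, and real dimensions are twice the complex ones.
  let Y : K →ₗ[ℝ] L :=
    { toFun := fun x => ⟨X x, h x x.2⟩
      map_add' := fun x y => Subtype.ext (map_add X (x : V) y)
      map_smul' := fun r x => Subtype.ext (by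
        have := map_smulₛₗ X (r : ℂ) (x : V)
        rw [Complex.conj_ofReal] at this
        exact this) }
  have hY : Function.Injective Y := by
    rw [← LinearMap.ker_eq_bot, LinearMap.ker_eq_bot']
    intro x hx
    exact Subtype.ext (h0 x x.2 (congrArg Subtype.val hx))
  have : FiniteDimensional ℝ L := FiniteDimensional.complexToReal L
  have h1 := LinearMap.finrank_le_finrank_of_injective hY
  rw [finrank_real_of_complex, finrank_real_of_complex] at h1
  omega

theorem finrank_le_of_linear {V : Type*} [AddCommGroup V] [Module ℂ V]
    (X : V →ₗ[ℂ] V) (K L : Submodule ℂ V) [FiniteDimensional ℂ L]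
    (h : ∀ x ∈ K, X x ∈ L) (h0 : ∀ x ∈ K, X x = 0 → x = 0) :
    Module.finrank ℂ K ≤ Module.finrank ℂ L := by
  refine LinearMap.finrank_le_finrank_of_injective (f := X.restrict h) ?_
  rw [← LinearMap.ker_eq_bot, LinearMap.ker_eq_bot']
  intro x hx
  exact Subtype.ext (h0 x x.2 (congrArg Subtype.val hx))

/-! ## Eigenspaces of compact self-adjoint operators -/

section Compact

variable {V : Type*} [NormedAddCommGroup V] [InnerProductSpace ℂ V]

/-- The kernel of `A - c`. -/
def kerSub (A : V →L[ℂ] V) (c : ℝ) : Submodule ℂ V :=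
  LinearMap.ker ((A - (c : ℂ) • 1 : V →L[ℂ] V) : V →ₗ[ℂ] V)

theorem mem_kerSub {A : V →L[ℂ] V} {c : ℝ} {x : V} : x ∈ kerSub A c ↔ A x = (c : ℂ) • x := by
  rw [kerSub, LinearMap.mem_ker]
  exact sub_eq_zero

theorem kerSub_eq_eigenspace (A : V →L[ℂ] V) (c : ℝ) :
    kerSub A c = Module.End.eigenspace (A : V →ₗ[ℂ] V) (c : ℂ) := by
  ext x
  rw [mem_kerSub, Module.End.mem_eigenspace_iff]
  rfl

/-- The orthogonal projection onto `L` is injective on `K`. This turns comparisons of quadratic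
forms into inequalities between dimensions. -/
theorem finrank_le_of_inf_orthogonal_eq_bot (K L : Submodule ℂ V) [FiniteDimensional ℂ L]
    (h : ∀ x ∈ K, x ∈ Lᗮ → x = 0) :
    FiniteDimensional ℂ K ∧ Module.finrank ℂ K ≤ Module.finrank ℂ L := by
  let f : K →ₗ[ℂ] L := (L.orthogonalProjectionOnto : V →ₗ[ℂ] L) ∘ₗ K.subtype
  have hf : Function.Injective f := by
    rw [← LinearMap.ker_eq_bot, LinearMap.ker_eq_bot']
    intro x hx
    exact Subtype.ext (h x x.2 (Submodule.orthogonalProjectionOnto_eq_zero_iff.mp hx))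
  exact ⟨Module.Finite.of_injective f hf, LinearMap.finrank_le_finrank_of_injective hf⟩

variable [CompleteSpace V]

theorem finiteDimensional_kerSub {A : V →L[ℂ] V} (hc : IsCompactOperator A) {c : ℝ} (h : c ≠ 0) :
    FiniteDimensional ℂ (kerSub A c) := by
  rw [kerSub_eq_eigenspace]
  exact ContinuousLinearMap.finite_dimensional_eigenspace hc _ (Complex.ofReal_ne_zero.mpr h)

theorem re_inner_le_of_spectrum_le {T : V →L[ℂ] V} (hT : IsSelfAdjoint T) {s : ℝ}
    (h : ∀ r ∈ spectrum ℝ T, r ≤ s) (x : V) : (⟪T x, x⟫_ℂ).re ≤ s * ‖x‖ ^ 2 := by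
  have h1 : T ≤ algebraMap ℝ (V →L[ℂ] V) s := le_algebraMap_of_spectrum_le h
  have h2 := ((ContinuousLinearMap.le_def _ _).mp h1).re_inner_nonneg_left x
  have h3 : (algebraMap ℝ (V →L[ℂ] V) s - T) x = (s : ℂ) • x - T x := rfl
  rw [h3, inner_sub_left, inner_smul_left, inner_self_eq_norm_sq_to_K, Complex.conj_ofReal] at h2
  have h4 : (RCLike.re ((s : ℂ) * ((‖x‖ : ℂ)) ^ 2 - ⟪T x, x⟫_ℂ) : ℝ) =
      s * ‖x‖ ^ 2 - (⟪T x, x⟫_ℂ).re := by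
    rw [map_sub]
    congr 1
    rw [← Complex.ofReal_pow, ← Complex.ofReal_mul]
    exact Complex.ofReal_re _
  have h5 := h4 ▸ h2
  linarith

/-- On an invariant subspace the quadratic form of a compact self-adjoint operator is bounded by
any strict upper bound of the eigenvalues. -/
theorem exists_re_inner_le {T : V →L[ℂ] V} (hT : IsSelfAdjoint T) (hc : IsCompactOperator T)
    {K : Submodule ℂ V} [CompleteSpace K] (hK : ∀ x ∈ K, T x ∈ K) {s : ℝ} (hs : 0 < s)
    (h : ∀ μ : ℝ, s ≤ μ → ∀ x ∈ K, T x = (μ : ℂ) • x → x = 0) :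
    ∃ r, 0 ≤ r ∧ r < s ∧ ∀ x ∈ K, (⟪T x, x⟫_ℂ).re ≤ r * ‖x‖ ^ 2 := by
  let S : K →L[ℂ] K := T.restrict hK
  have hSc : IsCompactOperator S := hc.restrict' hK
  have hSs : IsSelfAdjoint S := by
    rw [ContinuousLinearMap.isSelfAdjoint_iff_isSymmetric] at hT ⊢
    exact hT.restrict_invariant hK
  -- Nonzero spectral values of a compact operator are eigenvalues; here positivity of `s` enters.
  have hlt : ∀ r ∈ spectrum ℝ S, r < s := by
    intro r hr
    by_contra hrs
    rw [not_lt] at hrs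
    have hr0 : (r : ℂ) ≠ 0 := Complex.ofReal_ne_zero.mpr (hs.trans_le hrs).ne'
    have h1 : (r : ℂ) ∈ spectrum ℂ S := (spectrum.algebraMap_mem_iff ℂ).mpr hr
    obtain ⟨v, hv, hv0⟩ := ((hSc.hasEigenvalue_iff_mem_spectrum hr0).mpr h1).exists_hasEigenvector
    rw [Module.End.mem_eigenspace_iff] at hv
    exact hv0 (Subtype.ext (h r hrs v v.2 (congrArg Subtype.val hv)))
  have hbound : ∃ r, 0 ≤ r ∧ r < s ∧ ∀ t ∈ spectrum ℝ S, t ≤ r := by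
    rcases (spectrum ℝ S).eq_empty_or_nonempty with he | hne
    · exact ⟨0, le_rfl, hs, by simp [he]⟩
    · obtain ⟨m, hm⟩ := (spectrum.isCompact (𝕜 := ℝ) S).exists_isGreatest hne
      exact ⟨max m 0, le_max_right _ _, max_lt (hlt m hm.1) hs,
        fun t ht => (hm.2 ht).trans (le_max_left _ _)⟩
  obtain ⟨r, hr0, hrs, hr⟩ := hbound
  exact ⟨r, hr0, hrs, fun x hx => re_inner_le_of_spectrum_le hSs hr ⟨x, hx⟩⟩

/-- The span of the eigenspaces of `A` with eigenvalue at least `s`. -/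
def upperEigen (A : V →L[ℂ] V) (s : ℝ) : Submodule ℂ V :=
  ⨆ μ : {μ : ℝ // s ≤ μ}, kerSub A μ

omit [CompleteSpace V] in
theorem kerSub_le_upperEigen (A : V →L[ℂ] V) {s μ : ℝ} (h : s ≤ μ) :
    kerSub A μ ≤ upperEigen A s :=
  le_iSup (fun μ : {μ : ℝ // s ≤ μ} => kerSub A μ) ⟨μ, h⟩

omit [CompleteSpace V] in
theorem upperEigen_invariant (A : V →L[ℂ] V) (s : ℝ) :
    ∀ x ∈ upperEigen A s, A x ∈ upperEigen A s := by
  intro x hx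
  refine Submodule.iSup_induction _ (motive := fun x => A x ∈ upperEigen A s) hx ?_ ?_ ?_
  · intro μ y hy
    rw [mem_kerSub.mp hy]
    exact Submodule.smul_mem _ _ (kerSub_le_upperEigen A μ.2 hy)
  · simp
  · intro y z hy hz
    rw [map_add]
    exact add_mem hy hz

omit [CompleteSpace V] in
theorem orthogonalFamily_kerSub {A : V →L[ℂ] V} (hA : (A : V →ₗ[ℂ] V).IsSymmetric) (s : ℝ) :
    OrthogonalFamily ℂ (fun μ : {μ : ℝ // s ≤ μ} => kerSub A μ)
      fun μ => (kerSub A μ).subtypeₗᵢ := by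
  have h := hA.orthogonalFamily_eigenspaces.comp
    (γ := {μ : ℝ // s ≤ μ}) (f := fun μ => ((μ : ℝ) : ℂ))
    (Complex.ofReal_injective.comp Subtype.val_injective)
  intro μ ν hμν x y
  have hx : (x : V) ∈ Module.End.eigenspace (A : V →ₗ[ℂ] V) ((μ : ℝ) : ℂ) := by
    rw [← kerSub_eq_eigenspace]; exact x.2
  have hy : (y : V) ∈ Module.End.eigenspace (A : V →ₗ[ℂ] V) ((ν : ℝ) : ℂ) := by
    rw [← kerSub_eq_eigenspace]; exact y.2
  exact h hμν ⟨x, hx⟩ ⟨y, hy⟩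

omit [CompleteSpace V] in
-- Expanding a vector of the span in mutually orthogonal eigenvectors makes the form a weighted sum
-- with weights at least `s`.
theorem le_re_inner_of_mem_upperEigen {A : V →L[ℂ] V} (hA : (A : V →ₗ[ℂ] V).IsSymmetric) {s : ℝ}
    {x : V} (hx : x ∈ upperEigen A s) : s * ‖x‖ ^ 2 ≤ (⟪A x, x⟫_ℂ).re := by
  classical
  obtain ⟨f, hf⟩ := (Submodule.mem_iSup_iff_exists_finsupp _ _).mp hx
  obtain ⟨hf, hsum⟩ := hf
  have hO := orthogonalFamily_kerSub hA s
  let l : ∀ μ : {μ : ℝ // s ≤ μ}, kerSub A μ := fun μ => ⟨f μ, hf μ⟩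
  have hx1 : x = ∑ μ ∈ f.support, (kerSub A μ).subtypeₗᵢ (l μ) := hsum.symm
  have hx2 : A x = ∑ μ ∈ f.support, (kerSub A μ).subtypeₗᵢ (((μ : ℝ) : ℂ) • l μ) := by
    rw [hx1, map_sum]
    exact Finset.sum_congr rfl fun μ _ => mem_kerSub.mp (hf μ)
  have h1 : ‖x‖ ^ 2 = ∑ μ ∈ f.support, ‖l μ‖ ^ 2 := by
    rw [hx1]; exact hO.norm_sum l f.support
  have h2 : ⟪A x, x⟫_ℂ = ∑ μ ∈ f.support, ⟪((μ : ℝ) : ℂ) • l μ, l μ⟫_ℂ := by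
    rw [hx2, hx1]
    exact hO.inner_sum (fun μ => ((μ : ℝ) : ℂ) • l μ) l f.support
  rw [h1, h2, Finset.mul_sum, Complex.re_sum]
  refine Finset.sum_le_sum fun μ _ => ?_
  rw [inner_smul_left, Complex.conj_ofReal, Complex.re_ofReal_mul]
  have h3 : (⟪l μ, l μ⟫_ℂ).re = ‖l μ‖ ^ 2 := by
    have := inner_self_eq_norm_sq (𝕜 := ℂ) (l μ)
    exact this
  rw [h3]
  exact mul_le_mul_of_nonneg_right μ.2 (sq_nonneg _)

omit [CompleteSpace V] in
theorem abs_re_inner_sub_le (A A' : V →L[ℂ] V) (x : V) :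
    |(⟪A' x, x⟫_ℂ).re - (⟪A x, x⟫_ℂ).re| ≤ ‖A' - A‖ * ‖x‖ ^ 2 := by
  rw [← Complex.sub_re, ← inner_sub_left]
  have h1 : A' x - A x = (A' - A) x := rfl
  rw [h1]
  refine (Complex.abs_re_le_norm _).trans ((norm_inner_le_norm _ _).trans ?_)
  rw [sq, ← mul_assoc]
  exact mul_le_mul_of_nonneg_right ((A' - A).le_opNorm x) (norm_nonneg x)

/-- The total multiplicity of the eigenvalues near the top eigenvalue `1` is stable. -/
theorem exists_finrank_upperEigen_eq {A : V →L[ℂ] V} (hA : IsSelfAdjoint A)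
    (hc : IsCompactOperator A) (hle : ∀ μ : ℝ, 1 < μ → ∀ x, A x = (μ : ℂ) • x → x = 0) :
    ∃ η : ℝ, 0 < η ∧ η < 1 ∧ ∀ A' : V →L[ℂ] V, IsSelfAdjoint A' → IsCompactOperator A' →
      ‖A' - A‖ < η →
      FiniteDimensional ℂ (upperEigen A' (1 - η)) ∧
        Module.finrank ℂ (upperEigen A' (1 - η)) = Module.finrank ℂ (kerSub A 1) := by
  have hAs := (ContinuousLinearMap.isSelfAdjoint_iff_isSymmetric).mp hA
  have hfin : FiniteDimensional ℂ (kerSub A 1) := finiteDimensional_kerSub hc one_ne_zero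
  have hinv : ∀ x ∈ (kerSub A 1)ᗮ, A x ∈ (kerSub A 1)ᗮ := by
    rw [kerSub_eq_eigenspace]
    exact fun x hx => hAs.invariant_orthogonalComplement_eigenspace _ x hx
  obtain ⟨r, hr0, hr1, hr⟩ := exists_re_inner_le hA hc hinv one_pos fun μ hμ x hx hxμ => by
    rcases hμ.eq_or_lt with rfl | hμ
    · exact Submodule.disjoint_def.mp (Submodule.orthogonal_disjoint _) x (mem_kerSub.mpr hxμ) hx
    · exact hle μ hμ x hxμ
  -- The form of `A` is at most `r` off `ker (A - 1)`. The threshold `1 - η` is the midpoint of `r`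
  -- and 1, so a perturbation smaller than `η` cannot move the form across it from either side.
  refine ⟨(1 - r) / 2, by linarith, by linarith, fun A' hA' hc' hlt => ?_⟩
  set η := (1 - r) / 2 with hη
  have hA's := (ContinuousLinearMap.isSelfAdjoint_iff_isSymmetric).mp hA'
  have hzero : ∀ {x : V} {u v : ℝ}, u < v → v * ‖x‖ ^ 2 ≤ u * ‖x‖ ^ 2 → x = 0 := by
    intro x u v huv hx
    have h1 : ‖x‖ ^ 2 ≤ 0 := by nlinarith [sq_nonneg ‖x‖]
    exact norm_eq_zero.mp (pow_eq_zero_iff two_ne_zero |>.mp (le_antisymm h1 (sq_nonneg _)))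
  -- A vector of the span orthogonal to `ker (A - 1)` would have `A'`-form at least `1 - η` and at
  -- most `r + ‖A' - A‖ < 1 - η`, per unit norm squared.
  have hup := finrank_le_of_inf_orthogonal_eq_bot (upperEigen A' (1 - η)) (kerSub A 1)
    fun x hx hx' => by
      have h1 := le_re_inner_of_mem_upperEigen hA's hx
      have h2 := hr x hx'
      have h3 := (abs_le.mp (abs_re_inner_sub_le A A' x)).2
      refine hzero (u := r + ‖A' - A‖) (v := 1 - η) (by linarith) ?_
      rw [add_mul]
      linarith
  have hfd : FiniteDimensional ℂ (upperEigen A' (1 - η)) := hup.1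
  refine ⟨hup.1, le_antisymm hup.2 ?_⟩
  have hinv' : ∀ x ∈ (upperEigen A' (1 - η))ᗮ, A' x ∈ (upperEigen A' (1 - η))ᗮ := by
    intro x hx
    rw [Submodule.mem_orthogonal] at hx ⊢
    intro y hy
    rw [← ContinuousLinearMap.coe_coe, ← hA's y x]
    exact hx _ (upperEigen_invariant A' _ y hy)
  obtain ⟨r', -, hr1', hr'⟩ := exists_re_inner_le hA' hc' hinv' (s := 1 - η) (by linarith)
    fun μ hμ x hx hxμ => Submodule.disjoint_def.mp (Submodule.orthogonal_disjoint _) x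
      (kerSub_le_upperEigen A' hμ (mem_kerSub.mpr hxμ)) hx
  -- Conversely, on the complement of the span the `A'`-form is at most `r' < 1 - η`, whereas on
  -- `ker (A - 1)` it is at least `1 - ‖A' - A‖ > 1 - η`.
  refine (finrank_le_of_inf_orthogonal_eq_bot (kerSub A 1) (upperEigen A' (1 - η))
    fun x hx hx' => ?_).2
  have h1 : (⟪A x, x⟫_ℂ).re = ‖x‖ ^ 2 := by
    rw [mem_kerSub.mp hx, Complex.ofReal_one, one_smul]
    exact inner_self_eq_norm_sq (𝕜 := ℂ) x
  have h2 := hr' x hx'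
  have h3 := (abs_le.mp (abs_re_inner_sub_le A A' x)).1
  refine hzero (u := r' + ‖A' - A‖) (v := 1) (by linarith) ?_
  rw [add_mul]
  linarith

theorem finrank_biSup_eq_sum {ι W : Type*} [AddCommGroup W] [Module ℂ W]
    {N : ι → Submodule ℂ W} (h : iSupIndep N) [∀ i, FiniteDimensional ℂ (N i)] (F : Finset ι) :
    Module.finrank ℂ (⨆ i ∈ F, N i : Submodule ℂ W) = ∑ i ∈ F, Module.finrank ℂ (N i) := by
  classical
  induction F using Finset.induction_on with
  | empty =>
    have h0 : (⨆ i ∈ (∅ : Finset ι), N i) = ⊥ := by simp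
    rw [h0, finrank_bot, Finset.sum_empty]
  | insert i F hi ih =>
    have hd : Disjoint (N i) (⨆ j ∈ F, N j) := h.disjoint_biSup hi
    have hfd : FiniteDimensional ℂ (⨆ j ∈ F, N j : Submodule ℂ W) :=
      Submodule.finiteDimensional_finset_sup F N |> fun h => by rwa [Finset.sup_eq_iSup] at h
    have h1 := Submodule.finrank_sup_add_finrank_inf_eq (N i) (⨆ j ∈ F, N j)
    rw [hd.eq_bot, finrank_bot, add_zero] at h1
    rw [Finset.sum_insert hi, Finset.iSup_insert, h1, ih]

/-- Each nonzero member of an independent family adds at least one dimension, so only finitely many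
can be nonzero. -/
theorem exists_finset_finrank_iSup_eq_sum {ι W : Type*} [AddCommGroup W] [Module ℂ W]
    {N : ι → Submodule ℂ W} (h : iSupIndep N)
    (hfin : FiniteDimensional ℂ (⨆ i, N i : Submodule ℂ W)) :
    ∃ F : Finset ι, (∀ i ∉ F, N i = ⊥) ∧
      Module.finrank ℂ (⨆ i, N i : Submodule ℂ W) = ∑ i ∈ F, Module.finrank ℂ (N i) := by
  have hfd : ∀ i, FiniteDimensional ℂ (N i) := fun i =>
    Submodule.finiteDimensional_of_le (le_iSup N i)
  have hfinite : {i | N i ≠ ⊥}.Finite := by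
    by_contra hinf
    obtain ⟨F, hF, hcard⟩ := Set.Infinite.exists_subset_card_eq hinf
      (Module.finrank ℂ (⨆ i, N i : Submodule ℂ W) + 1)
    have h1 : F.card ≤ ∑ i ∈ F, Module.finrank ℂ (N i) := by
      rw [Finset.card_eq_sum_ones]
      refine Finset.sum_le_sum fun i hi => ?_
      exact Nat.one_le_iff_ne_zero.mpr fun e => hF hi (Submodule.finrank_eq_zero.mp e)
    rw [← finrank_biSup_eq_sum h F] at h1
    have h2 : Module.finrank ℂ (⨆ i ∈ F, N i : Submodule ℂ W) ≤
        Module.finrank ℂ (⨆ i, N i : Submodule ℂ W) := Submodule.finrank_mono (iSup₂_le fun i (_ : i ∈ F) => le_iSup N i)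
    omega
  refine ⟨hfinite.toFinset, fun i hi => by simpa using hi, ?_⟩
  have heq : (⨆ i, N i) = ⨆ i ∈ hfinite.toFinset, N i := by
    refine le_antisymm (iSup_le fun i => ?_) (iSup₂_le fun i _ => le_iSup N i)
    by_cases hi : N i = ⊥
    · rw [hi]; exact bot_le
    · exact le_iSup₂_of_le i (hfinite.mem_toFinset.mpr hi) le_rfl
  rw [← finrank_biSup_eq_sum h, ← heq]

omit [CompleteSpace V] in
/-- The dimension of the span of the upper eigenspaces modulo `m`, if the multiplicities of all
eigenvalues except `1` are divisible by `m`. -/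
theorem finrank_upperEigen_modEq {A : V →L[ℂ] V} (hA : (A : V →ₗ[ℂ] V).IsSymmetric) {s : ℝ}
    (hs : s ≤ 1) [FiniteDimensional ℂ (upperEigen A s)] {m : ℕ}
    (h : ∀ μ : ℝ, s ≤ μ → μ ≠ 1 → m ∣ Module.finrank ℂ (kerSub A μ)) :
    Module.finrank ℂ (upperEigen A s) ≡ Module.finrank ℂ (kerSub A 1) [MOD m] := by
  classical
  have hO := orthogonalFamily_kerSub hA s
  have hind : iSupIndep fun μ : {μ : ℝ // s ≤ μ} => kerSub A μ := hO.independent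
  have hfd : ∀ μ : {μ : ℝ // s ≤ μ}, FiniteDimensional ℂ (kerSub A μ) := fun μ =>
    Submodule.finiteDimensional_of_le (kerSub_le_upperEigen A μ.2)
  obtain ⟨F, hF, hFsum⟩ := exists_finset_finrank_iSup_eq_sum hind
    (show FiniteDimensional ℂ (⨆ μ : {μ : ℝ // s ≤ μ}, kerSub A μ : Submodule ℂ V) from ‹_›)
  -- The index 1 is inserted by hand because `ker (A - 1)` may be trivial and then missing from `F`.
  have hU : Module.finrank ℂ (upperEigen A s) =
      ∑ μ ∈ insert ⟨1, hs⟩ F, Module.finrank ℂ (kerSub A μ) := by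
    by_cases h1 : (⟨1, hs⟩ : {μ : ℝ // s ≤ μ}) ∈ F
    · rw [Finset.insert_eq_of_mem h1]; exact hFsum
    · rw [Finset.sum_insert h1, hF _ h1, finrank_bot, zero_add]; exact hFsum
  have h1 : (⟨1, hs⟩ : {μ : ℝ // s ≤ μ}) ∈ insert ⟨1, hs⟩ F := Finset.mem_insert_self _ _
  rw [hU, ← Finset.add_sum_erase _ _ h1]
  have h2 : m ∣ ∑ μ ∈ (insert ⟨1, hs⟩ F).erase ⟨1, hs⟩, Module.finrank ℂ (kerSub A μ) :=
    Finset.dvd_sum fun μ hμ => h μ μ.2 fun e => (Finset.ne_of_mem_erase hμ) (Subtype.ext e)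
  exact (Nat.ModEq.add_left _ (Nat.modEq_zero_iff_dvd.mpr h2))

end Compact

/-! ## Compact operators with a `ℤ₂` index -/

section Abstract

variable {V : Type*} [NormedAddCommGroup V] [InnerProductSpace ℂ V]

/-- The kernel of `A - c` in the subspace `γ = 1`. -/
def blockSub (γ A : V →L[ℂ] V) (c : ℝ) : Submodule ℂ V :=
  kerSub A c ⊓ LinearMap.ker ((γ - 1 : V →L[ℂ] V) : V →ₗ[ℂ] V)

theorem mem_blockSub {γ A : V →L[ℂ] V} {c : ℝ} {x : V} :
    x ∈ blockSub γ A c ↔ A x = (c : ℂ) • x ∧ γ x = x := by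
  rw [blockSub, Submodule.mem_inf, mem_kerSub, LinearMap.mem_ker]
  exact and_congr_right fun _ => sub_eq_zero

/-- The eigenspaces of an operator which commutes with a grading and with an involution that is odd
with respect to the grading have equal parts in both sectors. -/
theorem finrank_kerSub_eq_two_mul {γ A D : V →L[ℂ] V} (hγ : γ * γ = 1) (hγA : γ * A = A * γ)
    (hD : D * D = 1) (hγD : γ * D = -(D * γ)) (hDA : D * A = A * D) {c : ℝ}
    [FiniteDimensional ℂ (kerSub A c)] :
    Module.finrank ℂ (kerSub A c) = 2 * Module.finrank ℂ (blockSub γ A c) := by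
  have eγ : ∀ x, γ (γ x) = x := fun x => DFunLike.congr_fun hγ x
  have eγA : ∀ x, γ (A x) = A (γ x) := fun x => DFunLike.congr_fun hγA x
  have eD : ∀ x, D (D x) = x := fun x => DFunLike.congr_fun hD x
  have eγD : ∀ x, γ (D x) = -D (γ x) := fun x => DFunLike.congr_fun hγD x
  have eDA : ∀ x, D (A x) = A (D x) := fun x => DFunLike.congr_fun hDA x
  let L : Submodule ℂ V := kerSub A c ⊓ LinearMap.ker ((γ + 1 : V →L[ℂ] V) : V →ₗ[ℂ] V)
  have hL : ∀ {x}, x ∈ L ↔ A x = (c : ℂ) • x ∧ γ x = -x := by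
    intro x
    rw [Submodule.mem_inf, mem_kerSub, LinearMap.mem_ker]
    exact and_congr_right fun _ => eq_neg_iff_add_eq_zero.symm
  have : FiniteDimensional ℂ (blockSub γ A c) := Submodule.finiteDimensional_of_le inf_le_left
  have : FiniteDimensional ℂ L := Submodule.finiteDimensional_of_le inf_le_left
  have hinj : ∀ x, D x = 0 → x = 0 := fun x hx => by rw [← eD x, hx, map_zero]
  -- `D` commutes with `A` and reverses `γ`, so it exchanges the two sectors injectively in both
  -- directions.
  have h1 : Module.finrank ℂ (blockSub γ A c) = Module.finrank ℂ L := by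
    refine le_antisymm (finrank_le_of_linear (D : V →ₗ[ℂ] V) _ _ (fun x hx => ?_) fun x _ => hinj x)
      (finrank_le_of_linear (D : V →ₗ[ℂ] V) _ _ (fun x hx => ?_) fun x _ => hinj x)
    · obtain ⟨hx1, hx2⟩ := mem_blockSub.mp hx
      refine hL.mpr ⟨?_, ?_⟩
      · rw [ContinuousLinearMap.coe_coe, ← eDA, hx1, map_smul]
      · rw [ContinuousLinearMap.coe_coe, eγD, hx2]
    · obtain ⟨hx1, hx2⟩ := hL.mp hx
      refine mem_blockSub.mpr ⟨?_, ?_⟩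
      · rw [ContinuousLinearMap.coe_coe, ← eDA, hx1, map_smul]
      · rw [ContinuousLinearMap.coe_coe, eγD, hx2, map_neg, neg_neg]
  have hsup : blockSub γ A c ⊔ L = kerSub A c := by
    refine le_antisymm (sup_le inf_le_left inf_le_left) fun x hx => ?_
    have hAx := mem_kerSub.mp hx
    have hAγ : A (γ x) = (c : ℂ) • γ x := by rw [← eγA, hAx, map_smul]
    refine Submodule.mem_sup.mpr ⟨(2⁻¹ : ℂ) • (x + γ x), mem_blockSub.mpr ⟨?_, ?_⟩,
      (2⁻¹ : ℂ) • (x - γ x), hL.mpr ⟨?_, ?_⟩, ?_⟩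
    · rw [map_smul, map_add, hAx, hAγ, ← smul_add, smul_comm]
    · rw [map_smul, map_add, eγ, add_comm]
    · rw [map_smul, map_sub, hAx, hAγ, ← smul_sub, smul_comm]
    · rw [map_smul, map_sub, eγ, ← smul_neg, neg_sub]
    · rw [← smul_add, add_add_sub_cancel, ← two_smul ℂ x, smul_smul]
      norm_num
  have hinf : blockSub γ A c ⊓ L = ⊥ := by
    rw [Submodule.eq_bot_iff]
    intro x hx
    obtain ⟨hx1, hx2⟩ := Submodule.mem_inf.mp hx
    have h1 : x = -x := (mem_blockSub.mp hx1).2.symm.trans (hL.mp hx2).2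
    have h2 : (2 : ℂ) • x = 0 := by rw [two_smul]; exact eq_neg_iff_add_eq_zero.mp h1
    exact (smul_eq_zero.mp h2).resolve_left two_ne_zero
  have h2 := Submodule.finrank_sup_add_finrank_inf_eq (blockSub γ A c) L
  rw [hsup, hinf, finrank_bot, add_zero] at h2
  omega

variable [CompleteSpace V]

/-- A compact self-adjoint operator `A`, even with respect to the grading `γ`, whose symmetries
make half of the dimension of the kernel of `A - 1` a topological invariant modulo `2`. -/
structure HasKramersIndex (γ A : V →L[ℂ] V) : Prop where
  selfAdjoint : IsSelfAdjoint A
  compact : IsCompactOperator A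
  comm : γ * A = A * γ
  grading_sq : γ * γ = 1
  exists_flip : ∃ D : V →L[ℂ] V, D * D = 1 ∧ γ * D = -(D * γ) ∧ D * A = A * D
  exists_defect : ∃ B : V →L[ℂ] V, IsSelfAdjoint B ∧ B * B = 1 - A * A
  exists_kramers : ∃ X : V →ₛₗ[starRingEnd ℂ] V, (∀ x, X (A x) = A (X x)) ∧
    (∀ x, X (γ x) = γ (X x)) ∧ ∀ x, X (X x) = -(x - A (A x))
  exists_reflection : ∃ W : V →ₛₗ[starRingEnd ℂ] V, (∀ x, W (A x) = -A (W x)) ∧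
    ∀ x, W (W x) = x

namespace HasKramersIndex

variable {γ A : V →L[ℂ] V}

/-- For such an eigenvector `‖B x‖² = (1 - μ²) ‖x‖²`, where the right side would be negative. -/
theorem eq_zero_of_one_lt (h : HasKramersIndex γ A) {μ : ℝ} (hμ : 1 < μ) {x : V}
    (hx : A x = (μ : ℂ) • x) : x = 0 := by
  obtain ⟨B, hB, hBB⟩ := h.exists_defect
  have h1 : B (B x) = ((1 - μ ^ 2 : ℝ) : ℂ) • x := by
    have : B (B x) = x - A (A x) := DFunLike.congr_fun hBB x
    rw [this, hx, map_smul, hx, smul_smul, Complex.ofReal_sub, sub_smul]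
    simp [sq]
  have h2 : ⟪B x, B x⟫_ℂ = ((1 - μ ^ 2 : ℝ) : ℂ) * ⟪x, x⟫_ℂ := by
    rw [← ContinuousLinearMap.adjoint_inner_right, ← ContinuousLinearMap.star_eq_adjoint,
      hB.star_eq, h1, inner_smul_right]
  rw [inner_self_eq_norm_sq_to_K, inner_self_eq_norm_sq_to_K] at h2
  have h3 : ‖B x‖ ^ 2 = (1 - μ ^ 2) * ‖x‖ ^ 2 := Complex.ofReal_injective (by
    rw [Complex.ofReal_pow, Complex.ofReal_mul, Complex.ofReal_pow]; exact h2)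
  have h4 : ‖x‖ ^ 2 = 0 := by
    have : 1 - μ ^ 2 < 0 := by nlinarith
    nlinarith [sq_nonneg ‖B x‖, sq_nonneg ‖x‖]
  exact norm_eq_zero.mp (pow_eq_zero_iff two_ne_zero |>.mp h4)

theorem finiteDimensional (h : HasKramersIndex γ A) {c : ℝ} (hc : c ≠ 0) :
    FiniteDimensional ℂ (kerSub A c) := finiteDimensional_kerSub h.compact hc

theorem finrank_eq_two_mul (h : HasKramersIndex γ A) {c : ℝ} (hc : c ≠ 0) :
    Module.finrank ℂ (kerSub A c) = 2 * Module.finrank ℂ (blockSub γ A c) := by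
  have := h.finiteDimensional hc
  obtain ⟨D, hD, hγD, hDA⟩ := h.exists_flip
  exact finrank_kerSub_eq_two_mul h.grading_sq h.comm hD hγD hDA

theorem finrank_neg_eq (h : HasKramersIndex γ A) {c : ℝ} (hc : c ≠ 0) :
    Module.finrank ℂ (kerSub A c) = Module.finrank ℂ (kerSub A (-c)) := by
  have h1 := h.finiteDimensional hc
  have h2 := h.finiteDimensional (neg_ne_zero.mpr hc)
  obtain ⟨W, hWA, hWW⟩ := h.exists_reflection
  have hinj : ∀ x, W x = 0 → x = 0 := fun x hx => by rw [← hWW x, hx, map_zero]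
  have hmap : ∀ (b : ℝ), ∀ x ∈ kerSub A b, W x ∈ kerSub A (-b) := by
    intro b x hx
    rw [mem_kerSub] at hx ⊢
    rw [← neg_eq_iff_eq_neg.mpr (hWA x), hx, map_smulₛₗ, Complex.conj_ofReal, Complex.ofReal_neg,
      neg_smul]
  refine le_antisymm (finrank_le_of_antilinear W _ _ (hmap c) fun x _ => hinj x)
    (finrank_le_of_antilinear W _ _ (fun x hx => ?_) fun x _ => hinj x)
  have := hmap (-c) x hx
  rwa [neg_neg] at this

/-- The map `X` preserves the block, and its square there is the negative number `-(1 - c²)`, so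
Kramers degeneracy applies. The argument breaks down at `|c| = 1`, which is where the index lives.
-/
theorem even_finrank_blockSub (h : HasKramersIndex γ A) {c : ℝ} (h0 : 0 < |c|) (h1 : |c| < 1) :
    Even (Module.finrank ℂ (blockSub γ A c)) := by
  have hfd := h.finiteDimensional (abs_pos.mp h0)
  have : FiniteDimensional ℂ (blockSub γ A c) := Submodule.finiteDimensional_of_le inf_le_left
  obtain ⟨X, hXA, hXγ, hXX⟩ := h.exists_kramers
  refine even_finrank_submodule_of_antilinear X _ (c := 1 - c ^ 2) (fun x hx => ?_) ?_ fun x hx => ?_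
  · obtain ⟨hx1, hx2⟩ := mem_blockSub.mp hx
    refine mem_blockSub.mpr ⟨?_, ?_⟩
    · rw [← hXA, hx1, map_smulₛₗ, Complex.conj_ofReal]
    · rw [← hXγ, hx2]
  · have := (sq_lt_one_iff_abs_lt_one c).mpr h1
    linarith
  · obtain ⟨hx1, -⟩ := mem_blockSub.mp hx
    rw [hXX, hx1, map_smul, hx1, smul_smul, Complex.ofReal_sub, sub_smul]
    simp [sq]

/-- Half of the dimension of the kernel of `A - 1` is locally constant modulo `2`. -/
theorem exists_half_finrank_eq (h : HasKramersIndex γ A) :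
    ∃ η : ℝ, 0 < η ∧ ∀ A' : V →L[ℂ] V, HasKramersIndex γ A' → ‖A' - A‖ < η →
      ((Module.finrank ℂ (kerSub A' 1) / 2 : ℕ) : ZMod 2) =
        ((Module.finrank ℂ (kerSub A 1) / 2 : ℕ) : ZMod 2) := by
  obtain ⟨η, hη0, hη1, hη⟩ := exists_finrank_upperEigen_eq h.selfAdjoint h.compact
    fun μ hμ x hx => h.eq_zero_of_one_lt hμ hx
  refine ⟨η, hη0, fun A' h' hlt => ?_⟩
  obtain ⟨hfd, hdim⟩ := hη A' h'.selfAdjoint h'.compact hlt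
  -- Below 1 a multiplicity is twice an even number and above 1 it is 0. Hence the two kernel
  -- dimensions agree modulo 4, and being even they have halves that agree modulo 2.
  have hmod := finrank_upperEigen_modEq (m := 4)
    ((ContinuousLinearMap.isSelfAdjoint_iff_isSymmetric).mp h'.selfAdjoint)
    (show 1 - η ≤ 1 by linarith) fun μ hμ hμ1 => by
      rcases lt_or_gt_of_ne hμ1 with hlt1 | hgt1
      · have hμ0 : 0 < μ := by linarith
        rw [h'.finrank_eq_two_mul hμ0.ne']
        obtain ⟨k, hk⟩ := h'.even_finrank_blockSub (abs_pos.mpr hμ0.ne')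
          (by rwa [abs_of_pos hμ0])
        exact ⟨k, by omega⟩
      · have : kerSub A' μ = ⊥ := (Submodule.eq_bot_iff _).mpr fun x hx =>
          h'.eq_zero_of_one_lt hgt1 (mem_kerSub.mp hx)
        rw [this, finrank_bot]
        exact dvd_zero 4
  rw [hdim] at hmod
  have e1 := h.finrank_eq_two_mul one_ne_zero
  have e2 := h'.finrank_eq_two_mul one_ne_zero
  rw [ZMod.natCast_eq_natCast_iff]
  rw [Nat.ModEq] at hmod ⊢
  omega

end HasKramersIndex

/-! ## The difference of a projection and its conjugate -/

section Difference

variable {P D γ : V →L[ℂ] V}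

omit [CompleteSpace V] in
theorem grading_comm_conjugate (hγP : γ * P = P * γ) (hγD : γ * D = -(D * γ)) :
    γ * (D * P * D) = D * P * D * γ := by
  calc γ * (D * P * D) = (γ * D) * P * D := by noncomm_ring
    _ = -(D * (γ * P) * D) := by rw [hγD]; noncomm_ring
    _ = -(D * P * (γ * D)) := by rw [hγP]; noncomm_ring
    _ = D * P * D * γ := by rw [hγD]; noncomm_ring

/-- The operator `γ (P - D P D)`. -/
def differenceOp (γ P D : V →L[ℂ] V) : V →L[ℂ] V := γ * (P - D * P * D)

/-- The operator `1 - P - D P D`. -/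
def defectOp (P D : V →L[ℂ] V) : V →L[ℂ] V := 1 - P - D * P * D

omit [CompleteSpace V] in
theorem grading_comm_differenceOp (hγP : γ * P = P * γ) (hγD : γ * D = -(D * γ)) :
    γ * differenceOp γ P D = differenceOp γ P D * γ := by
  have h := grading_comm_conjugate hγP hγD
  rw [differenceOp]
  generalize D * P * D = Q at h
  rw [mul_assoc, sub_mul, mul_sub γ P, hγP, h]

omit [CompleteSpace V] in
theorem grading_comm_defectOp (hγP : γ * P = P * γ) (hγD : γ * D = -(D * γ)) :
    γ * defectOp P D = defectOp P D * γ := by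
  have h := grading_comm_conjugate hγP hγD
  rw [defectOp, mul_sub, mul_sub, sub_mul, sub_mul, hγP, h, one_mul, mul_one]

omit [CompleteSpace V] in
theorem mul_conjugate_cancel (hD : D * D = 1) : D * (D * P * D) = P * D := by
  rw [← mul_assoc, ← mul_assoc, hD, one_mul]

omit [CompleteSpace V] in
theorem conjugate_mul_cancel (hD : D * D = 1) : D * P * D * D = D * P := by
  rw [mul_assoc, hD, mul_one]

omit [CompleteSpace V] in
-- `D` exchanges `P` with `D P D` and so reverses their difference; the sign from `γ` compensates.
theorem flip_comm_differenceOp (hD : D * D = 1) (hγD : γ * D = -(D * γ)) :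
    D * differenceOp γ P D = differenceOp γ P D * D := by
  have h : D * γ = -(γ * D) := by rw [hγD, neg_neg]
  calc D * differenceOp γ P D = D * γ * (P - D * P * D) := by
        rw [differenceOp, mul_assoc D γ]
    _ = -(γ * (D * P - D * (D * P * D))) := by rw [h]; noncomm_ring
    _ = -(γ * (D * P - P * D)) := by rw [mul_conjugate_cancel hD]
    _ = γ * (P * D - D * P * D * D) := by rw [conjugate_mul_cancel hD]; noncomm_ring
    _ = differenceOp γ P D * D := by rw [differenceOp]; noncomm_ring

omit [CompleteSpace V] in
theorem flip_comm_defectOp (hD : D * D = 1) : D * defectOp P D = defectOp P D * D := by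
  rw [defectOp, mul_sub, mul_sub, sub_mul, sub_mul, mul_conjugate_cancel hD,
    conjugate_mul_cancel hD, one_mul, mul_one]
  abel

omit [CompleteSpace V] in
theorem conjugate_sq (hP : P * P = P) (hD : D * D = 1) :
    D * P * D * (D * P * D) = D * P * D := by
  calc D * P * D * (D * P * D) = D * P * (D * D) * P * D := by noncomm_ring
    _ = D * (P * P) * D := by rw [hD]; noncomm_ring
    _ = _ := by rw [hP]

omit [CompleteSpace V] in
theorem differenceOp_sq (hγ : γ * γ = 1) (hγP : γ * P = P * γ) (hγD : γ * D = -(D * γ)) :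
    differenceOp γ P D * differenceOp γ P D = (P - D * P * D) * (P - D * P * D) := by
  have h := grading_comm_differenceOp hγP hγD
  calc differenceOp γ P D * differenceOp γ P D
      = differenceOp γ P D * γ * (P - D * P * D) := by rw [differenceOp, mul_assoc _ γ]
    _ = γ * γ * (P - D * P * D) * (P - D * P * D) := by
        rw [← h, differenceOp, ← mul_assoc]
    _ = _ := by rw [hγ, one_mul]

omit [CompleteSpace V] in
-- For any two projections `(P - Q)² + (1 - P - Q)² = 1`.
theorem defectOp_sq (hP : P * P = P) (hD : D * D = 1) (hγ : γ * γ = 1) (hγP : γ * P = P * γ)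
    (hγD : γ * D = -(D * γ)) :
    defectOp P D * defectOp P D = 1 - differenceOp γ P D * differenceOp γ P D := by
  rw [differenceOp_sq hγ hγP hγD, defectOp]
  have hQ := conjugate_sq hP hD
  generalize D * P * D = Q at hQ
  have e1 : (1 - P - Q) * (1 - P - Q) = 1 - P - P - Q - Q + P * P + Q * Q + P * Q + Q * P := by
    noncomm_ring
  have e2 : 1 - (P - Q) * (P - Q) = 1 - P * P - Q * Q + P * Q + Q * P := by noncomm_ring
  rw [e1, e2, hP, hQ]
  abel

omit [CompleteSpace V] in
-- For two projections `P - Q` and `1 - P - Q` anticommute, and `γ` commutes with the latter.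
theorem differenceOp_mul_defectOp (hP : P * P = P) (hD : D * D = 1) (hγP : γ * P = P * γ)
    (hγD : γ * D = -(D * γ)) :
    defectOp P D * differenceOp γ P D = -(differenceOp γ P D * defectOp P D) := by
  have h := grading_comm_defectOp hγP hγD
  have key : defectOp P D * (P - D * P * D) = -((P - D * P * D) * defectOp P D) := by
    rw [defectOp]
    have hQ := conjugate_sq hP hD
    generalize D * P * D = Q at hQ
    have e1 : (1 - P - Q) * (P - Q) = P - Q - P * P + Q * Q + P * Q - Q * P := by noncomm_ring
    have e2 : -((P - Q) * (1 - P - Q)) = -P + Q + P * P - Q * Q + P * Q - Q * P := by noncomm_ring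
    rw [e1, e2, hP, hQ]
    abel
  calc defectOp P D * differenceOp γ P D = defectOp P D * γ * (P - D * P * D) := by
        rw [differenceOp, mul_assoc (defectOp P D) γ]
    _ = γ * (defectOp P D * (P - D * P * D)) := by rw [← h, mul_assoc]
    _ = -(γ * (P - D * P * D) * defectOp P D) := by rw [key, mul_neg, mul_assoc γ (P - D * P * D)]
    _ = -(differenceOp γ P D * defectOp P D) := by rw [differenceOp]

theorem isSelfAdjoint_conjugate (hP : IsSelfAdjoint P) (hD : IsSelfAdjoint D) :
    IsSelfAdjoint (D * P * D) := by
  rw [IsSelfAdjoint, star_mul, star_mul, hP.star_eq, hD.star_eq, mul_assoc]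

theorem isSelfAdjoint_differenceOp (hP : IsSelfAdjoint P) (hD : IsSelfAdjoint D)
    (hγ : IsSelfAdjoint γ) (hγP : γ * P = P * γ) (hγD : γ * D = -(D * γ)) :
    IsSelfAdjoint (differenceOp γ P D) := by
  have h := grading_comm_conjugate hγP hγD
  rw [IsSelfAdjoint, differenceOp, star_mul, hγ.star_eq,
    (hP.sub (isSelfAdjoint_conjugate hP hD)).star_eq, sub_mul, mul_sub, hγP, h]

omit [CompleteSpace V] in
-- Since `D² = 1`, the difference `P - D P D` is `D` times the commutator of `D` with `P`.
theorem isCompactOperator_differenceOp (hD : D * D = 1)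
    (hc : IsCompactOperator (D * P - P * D : V →L[ℂ] V)) :
    IsCompactOperator (differenceOp γ P D) := by
  have h : differenceOp γ P D = (γ * D) * (D * P - P * D) := by
    calc differenceOp γ P D = γ * (D * D * P - D * P * D) := by rw [differenceOp, hD, one_mul]
      _ = _ := by noncomm_ring
  rw [h]
  exact hc.clm_comp (γ * D)

/-- The algebraic and analytic hypotheses under which `γ (P - D P D)` has a `ℤ₂` index. -/
structure IsIndexTriple (γ P D : V →L[ℂ] V) : Prop where
  proj : IsStarProjection P
  flip_selfAdjoint : IsSelfAdjoint D
  flip_sq : D * D = 1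
  grading_selfAdjoint : IsSelfAdjoint γ
  grading_sq : γ * γ = 1
  grading_proj : γ * P = P * γ
  grading_flip : γ * D = -(D * γ)
  compact : IsCompactOperator (D * P - P * D : V →L[ℂ] V)

theorem IsIndexTriple.hasKramersIndex (h : IsIndexTriple γ P D)
    {X W : V →ₛₗ[starRingEnd ℂ] V}
    (hXA : ∀ x, X (differenceOp γ P D x) = differenceOp γ P D (X x))
    (hXγ : ∀ x, X (γ x) = γ (X x)) (hXX : ∀ x, X (X x) = -defectOp P D (defectOp P D x))
    (hWA : ∀ x, W (differenceOp γ P D x) = -differenceOp γ P D (W x)) (hWW : ∀ x, W (W x) = x) :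
    HasKramersIndex γ (differenceOp γ P D) where
  selfAdjoint := isSelfAdjoint_differenceOp h.proj.isSelfAdjoint h.flip_selfAdjoint
    h.grading_selfAdjoint h.grading_proj h.grading_flip
  compact := isCompactOperator_differenceOp h.flip_sq h.compact
  comm := grading_comm_differenceOp h.grading_proj h.grading_flip
  grading_sq := h.grading_sq
  exists_flip := ⟨D, h.flip_sq, h.grading_flip, flip_comm_differenceOp h.flip_sq h.grading_flip⟩
  exists_defect := ⟨defectOp P D, ((IsSelfAdjoint.one _).sub h.proj.isSelfAdjoint).sub
      (isSelfAdjoint_conjugate h.proj.isSelfAdjoint h.flip_selfAdjoint),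
    defectOp_sq h.proj.isIdempotentElem h.flip_sq h.grading_sq h.grading_proj h.grading_flip⟩
  exists_kramers := ⟨X, hXA, hXγ, fun x => by
    rw [hXX]
    exact congrArg Neg.neg (DFunLike.congr_fun (defectOp_sq h.proj.isIdempotentElem h.flip_sq
      h.grading_sq h.grading_proj h.grading_flip) x)⟩
  exists_reflection := ⟨W, hWA, hWW⟩

/-- An antilinear involution that commutes with the projection and anticommutes with the flip and
with the grading. -/
theorem IsIndexTriple.hasKramersIndex_of_comm (h : IsIndexTriple γ P D)
    {T : V →ₛₗ[starRingEnd ℂ] V} (hTT : ∀ x, T (T x) = x) (hTP : ∀ x, T (P x) = P (T x))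
    (hTD : ∀ x, T (D x) = -D (T x)) (hTγ : ∀ x, T (γ x) = -γ (T x)) :
    HasKramersIndex γ (differenceOp γ P D) := by
  have hTQ : ∀ x, T ((D * P * D) x) = (D * P * D) (T x) := by
    intro x
    show T (D (P (D x))) = D (P (D (T x)))
    rw [hTD, hTP, hTD, map_neg, map_neg, neg_neg]
  have hTA : ∀ x, T (differenceOp γ P D x) = -differenceOp γ P D (T x) := by
    intro x
    show T (γ (P x - (D * P * D) x)) = -γ (P (T x) - (D * P * D) (T x))
    rw [hTγ, map_sub, hTP, hTQ]
  have hTB : ∀ x, T (defectOp P D x) = defectOp P D (T x) := by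
    intro x
    show T (x - P x - (D * P * D) x) = T x - P (T x) - (D * P * D) (T x)
    rw [map_sub, map_sub, hTP, hTQ]
  have hDA : ∀ x, D (differenceOp γ P D x) = differenceOp γ P D (D x) := fun x =>
    DFunLike.congr_fun (flip_comm_differenceOp h.flip_sq h.grading_flip) x
  have hDB : ∀ x, D (defectOp P D x) = defectOp P D (D x) := fun x =>
    DFunLike.congr_fun (flip_comm_defectOp h.flip_sq) x
  have hBA : ∀ x, defectOp P D (differenceOp γ P D x) = -differenceOp γ P D (defectOp P D x) :=
    fun x => DFunLike.congr_fun (differenceOp_mul_defectOp h.proj.isIdempotentElem h.flip_sq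
      h.grading_proj h.grading_flip) x
  have hγB : ∀ x, γ (defectOp P D x) = defectOp P D (γ x) := fun x =>
    DFunLike.congr_fun (grading_comm_defectOp h.grading_proj h.grading_flip) x
  have hγD : ∀ x, γ (D x) = -D (γ x) := fun x => DFunLike.congr_fun h.grading_flip x
  have hDD : ∀ x, D (D x) = x := fun x => DFunLike.congr_fun h.flip_sq x
  -- `T` and `defectOp` both reverse `A`, so their product commutes with it; the factor `D` repairs
  -- the sign with respect to `γ` and makes the square negative.
  refine h.hasKramersIndex (W := T)
    (X := (T.comp (D : V →ₗ[ℂ] V)).comp (defectOp P D : V →ₗ[ℂ] V)) ?_ ?_ ?_ hTA hTT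
  · intro x
    show T (D (defectOp P D (differenceOp γ P D x))) = differenceOp γ P D (T (D (defectOp P D x)))
    rw [hBA, map_neg, hDA, map_neg, hTA, neg_neg]
  · intro x
    show T (D (defectOp P D (γ x))) = γ (T (D (defectOp P D x)))
    rw [← hγB, ← neg_eq_iff_eq_neg.mpr (hγD _), map_neg, hTγ, neg_neg]
  · intro x
    show T (D (defectOp P D (T (D (defectOp P D x))))) = -defectOp P D (defectOp P D x)
    rw [← hTB, ← hDB, ← neg_eq_iff_eq_neg.mpr (hTD _), hDD, map_neg, hTT]

/-- An antilinear involution that exchanges the projection with its complement and commutes with the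
flip and with the grading. -/
theorem IsIndexTriple.hasKramersIndex_of_exchange (h : IsIndexTriple γ P D)
    {T : V →ₛₗ[starRingEnd ℂ] V} (hTT : ∀ x, T (T x) = x) (hTP : ∀ x, T (P x) = T x - P (T x))
    (hTD : ∀ x, T (D x) = D (T x)) (hTγ : ∀ x, T (γ x) = γ (T x)) :
    HasKramersIndex γ (differenceOp γ P D) := by
  have hDD : ∀ x, D (D x) = x := fun x => DFunLike.congr_fun h.flip_sq x
  have hTQ : ∀ x, T ((D * P * D) x) = T x - (D * P * D) (T x) := by
    intro x
    show T (D (P (D x))) = T x - D (P (D (T x)))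
    rw [hTD, hTP, hTD, map_sub, hDD]
  have hTA : ∀ x, T (differenceOp γ P D x) = -differenceOp γ P D (T x) := by
    intro x
    show T (γ (P x - (D * P * D) x)) = -γ (P (T x) - (D * P * D) (T x))
    rw [hTγ, map_sub, hTP, hTQ, ← map_neg]
    congr 1
    abel
  have hTB : ∀ x, T (defectOp P D x) = -defectOp P D (T x) := by
    intro x
    show T (x - P x - (D * P * D) x) = -(T x - P (T x) - (D * P * D) (T x))
    rw [map_sub, map_sub, hTP, hTQ]
    abel
  have hBA : ∀ x, defectOp P D (differenceOp γ P D x) = -differenceOp γ P D (defectOp P D x) :=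
    fun x => DFunLike.congr_fun (differenceOp_mul_defectOp h.proj.isIdempotentElem h.flip_sq
      h.grading_proj h.grading_flip) x
  have hγB : ∀ x, γ (defectOp P D x) = defectOp P D (γ x) := fun x =>
    DFunLike.congr_fun (grading_comm_defectOp h.grading_proj h.grading_flip) x
  -- No factor `D` is needed here: `T` already commutes with `γ`, and the negative square comes from
  -- `T` anticommuting with `defectOp`.
  refine h.hasKramersIndex (W := T) (X := T.comp (defectOp P D : V →ₗ[ℂ] V)) ?_ ?_ ?_ hTA hTT
  · intro x
    show T (defectOp P D (differenceOp γ P D x)) = differenceOp γ P D (T (defectOp P D x))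
    rw [hBA, map_neg, hTA, neg_neg]
  · intro x
    show T (defectOp P D (γ x)) = γ (T (defectOp P D x))
    rw [← hγB, hTγ]
  · intro x
    show T (defectOp P D (T (defectOp P D x))) = -defectOp P D (defectOp P D x)
    rw [← neg_eq_iff_eq_neg.mpr (hTB _), map_neg, hTT]

end Difference

end Abstract

/-! ## The `ℤ₂` index of a gapped Hamiltonian -/

/-- In the `ℤ₂` entries of the table in even dimension `2n`, the time-reversal symmetry (`n` odd) or
the particle-hole symmetry (`n` even), combined with the antiunitary symmetry of the gamma matrices,
squares to `1`. -/
theorem periodicTable_even_Z2 {n : ℕ} (hn : 1 ≤ n) {c : CAZClass}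
    (hc : periodicTable c (2 * n) = TableEntry.Z2) :
    (Odd n ∧ c.trs ≠ 0 ∧ (-1 : ℂ) ^ ((n + 1) / 2) * (c.trs : ℂ) = 1) ∨
      (Even n ∧ c.phs ≠ 0 ∧ (-1 : ℂ) ^ ((n + 1) / 2) * (c.phs : ℂ) = 1) := by
  -- Columns are numbered from 0, so dimension `2n` is column `(2n - 1) % 8`; `1 ≤ n` keeps the
  -- subtraction exact.
  have key : ∀ r : Fin 8, (2 * n - 1) % 8 = r → tableRow c r = TableEntry.Z2 := by
    intro r hr
    have : Fin.ofNat 8 (2 * n - 1) = r := Fin.ext hr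
    rw [← this]
    exact hc
  have h4 : n % 4 = 0 ∨ n % 4 = 1 ∨ n % 4 = 2 ∨ n % 4 = 3 := by omega
  rcases h4 with h | h | h | h
  · have h1 := key 7 (by simp; omega)
    have hs : (-1 : ℂ) ^ ((n + 1) / 2) = 1 := Even.neg_one_pow (Nat.even_iff.mpr (by omega))
    refine Or.inr ⟨Nat.even_iff.mpr (by omega), ?_⟩
    rw [hs]
    cases c <;> simp [tableRow, CAZClass.phs] at h1 ⊢
  · have h1 := key 1 (by simp; omega)
    have hs : (-1 : ℂ) ^ ((n + 1) / 2) = -1 := Odd.neg_one_pow (Nat.odd_iff.mpr (by omega))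
    refine Or.inl ⟨Nat.odd_iff.mpr (by omega), ?_⟩
    rw [hs]
    cases c <;> simp [tableRow, CAZClass.trs] at h1 ⊢
  · have h1 := key 3 (by simp; omega)
    have hs : (-1 : ℂ) ^ ((n + 1) / 2) = -1 := Odd.neg_one_pow (Nat.odd_iff.mpr (by omega))
    refine Or.inr ⟨Nat.even_iff.mpr (by omega), ?_⟩
    rw [hs]
    cases c <;> simp [tableRow, CAZClass.phs] at h1 ⊢
  · have h1 := key 5 (by simp; omega)
    have hs : (-1 : ℂ) ^ ((n + 1) / 2) = 1 := Even.neg_one_pow (Nat.even_iff.mpr (by omega))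
    refine Or.inl ⟨Nat.odd_iff.mpr (by omega), ?_⟩
    rw [hs]
    cases c <;> simp [tableRow, CAZClass.trs] at h1 ⊢

theorem isCompactOperator_dirac_commutator {n M : ℕ} (a : EuclideanSpace ℝ (Fin (2 * n)))
    {P : WaveFn (2 * n) M →L[ℂ] WaveFn (2 * n) M}
    (hP : ∀ j, IsCompactOperator (unitPosition M a j * P - P * unitPosition M a j)) :
    IsCompactOperator
      (dirac n M a * tensorOp P 1 - tensorOp P 1 * dirac n M a : SpinWaveFn n M →L[ℂ] _) := by
  have h : dirac n M a * tensorOp P 1 - tensorOp P 1 * dirac n M a =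
      ∑ j, tensorOp (unitPosition M a j * P - P * unitPosition M a j) (gammaMat n j) := by
    rw [dirac, Finset.sum_mul, Finset.mul_sum, ← Finset.sum_sub_distrib]
    refine Finset.sum_congr rfl fun j _ => ?_
    rw [tensorOp_mul, tensorOp_mul, mul_one, one_mul, tensorOp_sub_left]
  rw [h]
  exact sum_mem (S := compactOperator (RingHom.id ℂ) (SpinWaveFn n M) (SpinWaveFn n M))
    fun j _ => isCompactOperator_tensorOp (hP j) _

theorem isIndexTriple {n M : ℕ} {a : EuclideanSpace ℝ (Fin (2 * n))}
    (ha : ∀ x : Site (2 * n), a ≠ x.toEuclid) {H : WaveFn (2 * n) M →L[ℂ] WaveFn (2 * n) M}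
    (hH : IsTightBinding H) {E : ℝ} (hE : (E : ℂ) ∉ spectrum ℂ H) :
    IsIndexTriple (grading n M) (tensorOp (fermiProj H E) 1) (dirac n M a) where
  proj := by
    have h := isStarProjection_projBelow H E
    refine ⟨?_, ?_⟩
    · rw [IsIdempotentElem, tensorOp_mul, one_mul]
      exact congrArg (tensorOp · 1) h.isIdempotentElem
    · rw [IsSelfAdjoint, tensorOp_star, Matrix.conjTranspose_one]
      exact congrArg (tensorOp · 1) h.isSelfAdjoint
  flip_selfAdjoint := dirac_isSelfAdjoint a
  flip_sq := dirac_sq ha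
  grading_selfAdjoint := grading_isSelfAdjoint
  grading_sq := grading_sq
  grading_proj := grading_mul_tensorOp_one _
  grading_flip := grading_mul_dirac a
  compact := by
    obtain ⟨R, hR⟩ := hH.exists_hasRange
    refine isCompactOperator_dirac_commutator a fun j => ?_
    rw [fermiProj, projBelow_eq_cfc hH.isSelfAdjoint hE]
    exact isCompactOperator_commutator_cfc hH.isSelfAdjoint (hR.isCompactOperator_commutator a j) _

theorem antiTensor_dirac {n M : ℕ} (u : Matrix (Fin M) (Fin M) ℂ)
    (a : EuclideanSpace ℝ (Fin (2 * n))) (φ : SpinWaveFn n M) :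
    antiTensor (antiMap (2 * n) u) (spinConj n) (dirac n M a φ) =
      (-1 : ℂ) ^ n • dirac n M a (antiTensor (antiMap (2 * n) u) (spinConj n) φ) := by
  have h1 : ∀ ψ : SpinWaveFn n M, dirac n M a ψ =
      ∑ j, tensorOp (unitPosition M a j) (gammaMat n j) ψ := fun ψ => sum_apply _ _ _
  rw [h1, h1, map_sum, Finset.smul_sum]
  refine Finset.sum_congr rfl fun j _ => ?_
  rw [antiTensor_tensorOp (antiMap_unitPosition u a j) (spinConj_mul_gammaMat j),
    tensorOp_smul_right]
  rfl

theorem antiTensor_grading {n M : ℕ} (u : Matrix (Fin M) (Fin M) ℂ) (φ : SpinWaveFn n M) :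
    antiTensor (antiMap (2 * n) u) (spinConj n) (grading n M φ) =
      (-1 : ℂ) ^ n • grading n M (antiTensor (antiMap (2 * n) u) (spinConj n) φ) := by
  rw [grading, antiTensor_tensorOp (K' := 1) (fun _ => rfl) spinConj_mul_gammaLast,
    tensorOp_smul_right]
  rfl

theorem antiTensor_tensorOp_one {n M : ℕ} {Θ : WaveFn (2 * n) M →SL[starRingEnd ℂ] WaveFn (2 * n) M}
    {K K' : WaveFn (2 * n) M →L[ℂ] WaveFn (2 * n) M} (hK : ∀ φ, Θ (K φ) = K' (Θ φ))
    (C : Matrix (Spin n) (Spin n) ℂ) (φ : SpinWaveFn n M) :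
    antiTensor Θ C (tensorOp K 1 φ) = tensorOp K' 1 (antiTensor Θ C φ) := by
  refine antiTensor_tensorOp hK ?_ φ
  rw [Matrix.map_one _ (map_zero _) (map_one _), mul_one, one_mul]

/-- Stated for a spectral gap rather than for `ResolventDecay`, since a perturbed Hamiltonian
inherits the former but is not assumed to satisfy the latter. The parity of `n` decides which
antilinear symmetry is used. -/
theorem hasKramersIndex_opA {n M : ℕ} (hn : 1 ≤ n) {c : CAZClass}
    (hc : periodicTable c (2 * n) = TableEntry.Z2) (S : SymmetryOps c (2 * n) M) {E : ℝ}
    (hE : c.phs ≠ 0 ∨ c.chs ≠ 0 → E = 0) {a : EuclideanSpace ℝ (Fin (2 * n))}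
    (ha : ∀ x : Site (2 * n), a ≠ x.toEuclid) {H : WaveFn (2 * n) M →L[ℂ] WaveFn (2 * n) M}
    (hH : IsTightBinding H) (hgap : (E : ℂ) ∉ spectrum ℂ H) (hS : S.Preserves H) :
    HasKramersIndex (grading n M) (opA a H E) := by
  have h := isIndexTriple ha hH hgap
  rcases periodicTable_even_Z2 hn hc with ⟨hodd, hne, hsign⟩ | ⟨heven, hne, hsign⟩
  · have hTD := antiTensor_dirac S.timeRev a
    have hTγ := antiTensor_grading (n := n) S.timeRev
    rw [hodd.neg_one_pow] at hTD hTγ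
    refine h.hasKramersIndex_of_comm (T := antiTensor (antiMap (2 * n) S.timeRev) (spinConj n))
      (fun φ => ?_) (fun φ => ?_) (fun φ => ?_) fun φ => ?_
    · rw [antiTensor_antiTensor (S.timeRev_sq hne) spinConj_mul_conj, hsign, one_smul]
    · exact antiTensor_tensorOp_one
        (projBelow_antilinear_comm hH.isSelfAdjoint hgap (hS.1 hne)) _ φ
    · exact (hTD φ).trans (neg_one_smul ℂ _)
    · exact (hTγ φ).trans (neg_one_smul ℂ _)
  · have hE0 : E = 0 := hE (Or.inl hne)
    subst hE0
    have hTD := antiTensor_dirac S.partHole a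
    have hTγ := antiTensor_grading (n := n) S.partHole
    rw [heven.neg_one_pow] at hTD hTγ
    refine h.hasKramersIndex_of_exchange (T := antiTensor (antiMap (2 * n) S.partHole) (spinConj n))
      (fun φ => ?_) (fun φ => ?_) (fun φ => ?_) fun φ => ?_
    · rw [antiTensor_antiTensor (S.partHole_sq hne) spinConj_mul_conj, hsign, one_smul]
    · refine (antiTensor_tensorOp_one
        (projBelow_antilinear_anticomm hH.isSelfAdjoint hgap (hS.2.1 hne)) _ φ).trans ?_
      rw [tensorOp_sub_left, tensorOp_one]
      rfl
    · exact (hTD φ).trans (one_smul ℂ _)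
    · exact (hTγ φ).trans (one_smul ℂ _)

/-! ### Norm continuity of `A` in the Hamiltonian. -/

theorem continuousOn_opA {n M : ℕ} (a : EuclideanSpace ℝ (Fin (2 * n))) (E : ℝ) :
    ContinuousOn (fun H : WaveFn (2 * n) M →L[ℂ] WaveFn (2 * n) M => opA a H E)
      {H | IsSelfAdjoint H ∧ (E : ℂ) ∉ spectrum ℂ H} := by
  have h1 : ContinuousOn
      (fun H : WaveFn (2 * n) M →L[ℂ] WaveFn (2 * n) M => tensorOp (fermiProj H E) 1)
      {H | IsSelfAdjoint H ∧ (E : ℂ) ∉ spectrum ℂ H} :=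
    (continuous_tensorOp 1).comp_continuousOn (continuousOn_projBelow E)
  exact continuousOn_const.mul (h1.sub ((continuousOn_const.mul h1).mul continuousOn_const))

theorem exists_opA_near {n M : ℕ} (a : EuclideanSpace ℝ (Fin (2 * n))) {E : ℝ}
    {H : WaveFn (2 * n) M →L[ℂ] WaveFn (2 * n) M} (hH : IsSelfAdjoint H)
    (hgap : (E : ℂ) ∉ spectrum ℂ H) {η : ℝ} (hη : 0 < η) :
    ∃ δ : ℝ, 0 < δ ∧ ∀ H' : WaveFn (2 * n) M →L[ℂ] WaveFn (2 * n) M, IsSelfAdjoint H' →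
      ‖H' - H‖ < δ → (E : ℂ) ∉ spectrum ℂ H' ∧ ‖opA a H' E - opA a H E‖ < η := by
  obtain ⟨δ₁, hδ₁, h₁⟩ := Metric.continuousWithinAt_iff.mp
    (continuousOn_opA (n := n) a E H ⟨hH, hgap⟩) η hη
  obtain ⟨δ₂, hδ₂, h₂⟩ := Metric.isOpen_iff.mp
    (isOpen_setOf_notMem_spectrum (V := WaveFn (2 * n) M) (E : ℂ)) H hgap
  refine ⟨min δ₁ δ₂, lt_min hδ₁ hδ₂, fun H' hH' hlt => ?_⟩
  have hgap' : (E : ℂ) ∉ spectrum ℂ H' :=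
    h₂ (by rw [Metric.mem_ball, dist_eq_norm]; exact hlt.trans_le (min_le_right _ _))
  refine ⟨hgap', ?_⟩
  have := h₁ ⟨hH', hgap'⟩ (by rw [dist_eq_norm]; exact hlt.trans_le (min_le_left _ _))
  rwa [dist_eq_norm] at this

theorem ResolventDecay.notMem_spectrum {d M : ℕ} {H : WaveFn d M →L[ℂ] WaveFn d M} {E : ℝ}
    (h : ResolventDecay H E) (hH : IsSelfAdjoint H) : (E : ℂ) ∉ spectrum ℂ H := by
  obtain ⟨K, hK⟩ := h.exists_norm_resolvent_le
  exact notMem_spectrum_of_resolvent_bounded hH hK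

end TopIns

end

/-! ### The main theorem. -/

open TopIns
theorem theorem2 (n M : ℕ) (hn : 1 ≤ n) (c : CAZClass) (hc : periodicTable c (2 * n) = TableEntry.Z2)
    (S : SymmetryOps c (2 * n) M) (E : ℝ) (hE : c.phs ≠ 0 ∨ c.chs ≠ 0 → E = 0)
    (a : EuclideanSpace ℝ (Fin (2 * n))) (ha : ∀ x : Site (2 * n), a ≠ x.toEuclid) :
    (∀ H : WaveFn (2 * n) M →L[ℂ] WaveFn (2 * n) M,
      IsTightBinding H → ResolventDecay H E → S.Preserves H →
        -- the integer-valued index is an honest difference of dimensions and vanishes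
        (FiniteDimensional ℂ (kerA a H E 1) ∧ FiniteDimensional ℂ (kerA a H E (-1)) ∧
          integerIndex a H E = 0) ∧
        -- half of the dimension of the kernel of `A - 1` is an integer
        Module.finrank ℂ (kerA a H E 1) = 2 * Module.finrank ℂ (kerBlock a H E 1) ∧
        -- the eigenvalues strictly between `0` and `1` in modulus have even multiplicities
        (∀ lam : ℝ, 0 < |lam| → |lam| < 1 →
          FiniteDimensional ℂ (kerA a H E lam) ∧
          Module.finrank ℂ (kerA a H E lam) = 2 * Module.finrank ℂ (kerBlock a H E lam) ∧
          Even (Module.finrank ℂ (kerBlock a H E lam))) ∧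
        -- the `ℤ₂` index is locally constant in the norm under symmetric perturbations
        ∃ δ : ℝ, 0 < δ ∧ ∀ H' : WaveFn (2 * n) M →L[ℂ] WaveFn (2 * n) M,
          IsTightBinding H' → S.Preserves H' → ‖H' - H‖ < δ →
            FiniteDimensional ℂ (kerA a H' E 1) ∧ z2Index a H' E = z2Index a H E) ∧
    -- the `ℤ₂` index is constant along symmetric norm-continuous deformations
    (∀ h : ℝ → WaveFn (2 * n) M →L[ℂ] WaveFn (2 * n) M,
      ContinuousOn h (Set.Icc 0 1) →
      (∀ g ∈ Set.Icc (0 : ℝ) 1,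
        IsTightBinding (h g) ∧ ResolventDecay (h g) E ∧ S.Preserves (h g)) →
      ∀ g ∈ Set.Icc (0 : ℝ) 1, z2Index a (h g) E = z2Index a (h 0) E) := by
  have stable : ∀ H : WaveFn (2 * n) M →L[ℂ] WaveFn (2 * n) M,
      IsTightBinding H → ResolventDecay H E → S.Preserves H →
      ∃ δ : ℝ, 0 < δ ∧ ∀ H' : WaveFn (2 * n) M →L[ℂ] WaveFn (2 * n) M,
        IsTightBinding H' → S.Preserves H' → ‖H' - H‖ < δ →
          FiniteDimensional ℂ (kerA a H' E 1) ∧ z2Index a H' E = z2Index a H E := by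
    intro H hH hdecay hS
    have hgap := hdecay.notMem_spectrum hH.isSelfAdjoint
    obtain ⟨η, hη, hstable⟩ := (hasKramersIndex_opA hn hc S hE ha hH hgap hS).exists_half_finrank_eq
    obtain ⟨δ, hδ, hnear⟩ := exists_opA_near a hH.isSelfAdjoint hgap hη
    refine ⟨δ, hδ, fun H' hH' hS' hlt => ?_⟩
    obtain ⟨hgap', hlt'⟩ := hnear H' hH'.isSelfAdjoint hlt
    have hK' := hasKramersIndex_opA hn hc S hE ha hH' hgap' hS'
    exact ⟨hK'.finiteDimensional one_ne_zero, hstable _ hK' hlt'⟩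
  refine ⟨fun H hH hdecay hS => ?_, fun h hcont hh g hg => ?_⟩
  · have hK := hasKramersIndex_opA hn hc S hE ha hH (hdecay.notMem_spectrum hH.isSelfAdjoint) hS
    refine ⟨⟨hK.finiteDimensional one_ne_zero, hK.finiteDimensional (neg_ne_zero.mpr one_ne_zero),
      ?_⟩, hK.finrank_eq_two_mul one_ne_zero, fun lam h0 h1 =>
        ⟨hK.finiteDimensional (abs_pos.mp h0), hK.finrank_eq_two_mul (abs_pos.mp h0),
          hK.even_finrank_blockSub h0 h1⟩, stable H hH hdecay hS⟩
    have h1 : Module.finrank ℂ (kerA a H E 1) = Module.finrank ℂ (kerA a H E (-1)) :=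
      hK.finrank_neg_eq one_ne_zero
    rw [integerIndex, h1, sub_self, mul_zero]
  · let top : TopologicalSpace (ZMod 2) := ⊥
    have hdisc : DiscreteTopology (ZMod 2) := ⟨rfl⟩
    have hc' : ContinuousOn (fun g => z2Index a (h g) E) (Set.Icc 0 1) := by
      intro t ht
      obtain ⟨hH, hdecay, hS⟩ := hh t ht
      obtain ⟨δ, hδ, hst⟩ := stable (h t) hH hdecay hS
      refine (continuousWithinAt_const (b := z2Index a (h t) E)).congr_of_eventuallyEq ?_ rfl
      have hev := (hcont t ht).eventually (Metric.ball_mem_nhds (h t) hδ)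
      filter_upwards [hev, self_mem_nhdsWithin] with s hs hsI
      rw [dist_eq_norm] at hs
      exact (hst (h s) (hh s hsI).1 (hh s hsI).2.2 hs).2
    exact isPreconnected_Icc.constant hc' hg (Set.left_mem_Icc.mpr zero_le_one)
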